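/- For every $N\ge 1$ let $P_N=(k_N(x,y))$ be the transition matrix of an irreducible birth-and-death chain on $\{0,\dots,N\}$ in discrete time (a stochastic matrix with $k_N(x,y)=0$ for $|x-y|\ge 2$ and $k_N(x,y)>0$ for $|x-y|=1$), symmetric in the sense that $k_N(N-x,N-y)=k_N(x,y)$ for all $x,y$. Let $\pi_N$ be its stationary distribution, let $1=\lambda_0>\lambda_1>\cdots>\lambda_N$ be its eigenvalues ($\lambda_k=\lambda_k^{(N)}$), let $(X_n)_{n\ge0}$ be the chain started at $0$, let $T_x=\inf\{n\ge0: X_n=x\}$, and let $d^{(N)}(n)=\tfrac12\sum_x|P_N^n(0,x)-\pi_N(x)|$ be the total variation distance to stationarity. Put $x^*=x^*_N=[N/2]+1$. Suppose that 1. $x^*$ is a halting state for total variation: $d^{(N)}(n)\le \mathbb P(T_{x^*}>n)$ for all $n\ge 0$ and all $N\ge 1$; 2. $(1-\lambda_1)\sum_{k=1}^N \frac1{1-\lambda_k}\to+\infty$ as $N\to\infty$; 3. $\limsup_{N\to\infty,\ N\text{ even}}\pi_N(N/2)<1$ (equivalently, $\liminf_{N\to\infty}\pi_N(\{x^*_N,\dots,N\})>0$;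 for odd $N$ this mass is always $\tfrac12$). Then: (a) the chain has a cutoff at $t_N=\mathbb E[T_{x^*}]$ for total variation: $d^{(N)}([ct_N])\to0$ for every $c>1$ and $d^{(N)}([ct_N])\to1$ for every $0\le c<1$; (b) $\mathbb E[T_{x^*}]\sim\frac12\sum_{k=1}^N\frac1{1-\lambda_k}$; (c) if moreover $\liminf_{N\to\infty}(1-\lambda_1)^2\sum_{k=1}^N\frac{\lambda_k}{(1-\lambda_k)^2}>0$, then the chain has a cutoff at time $\mathbb E[T_{x^*}]$ with window $\sigma(T_{x^*})$ (the standard deviation), and also a cutoff at time $\frac12\sum_{k=1}^N\frac1{1-\lambda_k}$ with window $\frac12\Big(\sum_{k=1}^N\frac{\lambda_k}{(1-\lambda_k)^2}\Big)^{1/2}$. Here a cutoff at $t_N$ with window $w_N$ means that $w_N=o(t_N)$, $\lim_{\gamma\to\infty}\liminf_{N\to\infty}d^{(N)}([t_N-\gamma w_N])=1$ and $\lim_{\gamma\to\infty}\limsup_{N\to\infty}d^{(N)}([t_N+\gamma w_N])=0$. -/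

import Mathlib

open Filter Topology MeasureTheory Asymptotics

noncomputable section

namespace BDCutoff

/-- `P` is the transition matrix of an irreducible birth-and-death chain on `{0, …, N}`: a stochastic
matrix with jumps of size at most one, all of whose entries `p_x = P x (x+1)` and
`q_{x+1} = P (x+1) x` are positive. -/
structure IsBirthDeath {N : ℕ} (P : Matrix (Fin (N + 1)) (Fin (N + 1)) ℝ) : Prop where
  nonneg : ∀ x y, 0 ≤ P x y
  row_sum : ∀ x, ∑ y, P x y = 1
  tridiagonal : ∀ x y : Fin (N + 1), (x : ℕ) + 1 < y ∨ (y : ℕ) + 1 < x → P x y = 0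
  up_pos : ∀ x y : Fin (N + 1), (x : ℕ) + 1 = y → 0 < P x y
  down_pos : ∀ x y : Fin (N + 1), (x : ℕ) + 1 = y → 0 < P y x

/-- `k(N - x, N - y) = k(x, y)`; `Fin.rev x` is `N - x`. -/
def IsSymmetricChain {N : ℕ} (P : Matrix (Fin (N + 1)) (Fin (N + 1)) ℝ) : Prop :=
  ∀ x y, P x.rev y.rev = P x y

/-- `π` is a probability vector with `π P = π`. -/
structure IsStationary {N : ℕ} (P : Matrix (Fin (N + 1)) (Fin (N + 1)) ℝ)
    (π : Fin (N + 1) → ℝ) : Prop where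
  nonneg : ∀ x, 0 ≤ π x
  sum_eq_one : ∑ x, π x = 1
  invariant : Matrix.vecMul π P = π

/-- `lam 0 > lam 1 > ⋯ > lam N` is the decreasing enumeration of the eigenvalues of `P`. -/
structure IsSpectrumEnum {N : ℕ} (P : Matrix (Fin (N + 1)) (Fin (N + 1)) ℝ)
    (lam : ℕ → ℝ) : Prop where
  strictAnti : StrictAntiOn lam (Set.Iic N)
  spectrum_eq : spectrum ℝ P = lam '' Set.Iic N

/-- `X` is a (time-homogeneous, discrete-time) Markov chain with transition matrix `P`, started at
`0`, on the probability space `(Ω, μ)`. -/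
structure IsMarkovChainFromZero {N : ℕ} (P : Matrix (Fin (N + 1)) (Fin (N + 1)) ℝ)
    {Ω : Type*} [MeasurableSpace Ω] (μ : Measure Ω) (X : ℕ → Ω → Fin (N + 1)) : Prop where
  measurable : ∀ n, Measurable (X n)
  law : ∀ (n : ℕ) (s : ℕ → Fin (N + 1)),
    μ.real {ω | ∀ i ≤ n, X i ω = s i} =
      if s 0 = 0 then ∏ i ∈ Finset.range n, P (s i) (s (i + 1)) else 0

/-- Total variation distance of two probability vectors. -/
def tvDist {N : ℕ} (ν π : Fin (N + 1) → ℝ) : ℝ :=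
  (1 / 2) * ∑ x, |ν x - π x|

/-- `d(n) = ‖π_n - π‖_TV`, with `π_n = δ_0 P^n` the law at time `n` of the chain started at `0`. -/
def tvDistAt {N : ℕ} (P : Matrix (Fin (N + 1)) (Fin (N + 1)) ℝ) (π : Fin (N + 1) → ℝ) (n : ℕ) : ℝ :=
  tvDist (fun x => (P ^ n) 0 x) π

/-- The hitting time `T_x = inf {n ≥ 0 | X_n = x}`, equal to `⊤` if `x` is never visited. -/
def hitTime {S Ω : Type*} (X : ℕ → Ω → S) (x : S) : Ω → WithTop ℕ :=
  hittingAfter X {x} 0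

/-- `T_x` as a real random variable; the (null) event that `x` is never visited is sent to `0`. -/
def hitTimeReal {S Ω : Type*} (X : ℕ → Ω → S) (x : S) (ω : Ω) : ℝ :=
  (((hitTime X x ω).untopD 0 : ℕ) : ℝ)

/-- `E[T_x]`. -/
def meanHit {S Ω : Type*} [MeasurableSpace Ω] (μ : Measure Ω) (X : ℕ → Ω → S) (x : S) : ℝ :=
  ∫ ω, hitTimeReal X x ω ∂μ

/-- `σ(T_x)`, the standard deviation of `T_x`. -/
def stdHit {S Ω : Type*} [MeasurableSpace Ω] (μ : Measure Ω) (X : ℕ → Ω → S) (x : S) : ℝ :=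
  Real.sqrt (ProbabilityTheory.variance (hitTimeReal X x) μ)

/-- `x` is a halting state for total variation: `d(n) ≤ ℙ(T_x > n)` for all `n`. -/
def IsHaltingState {N : ℕ} (P : Matrix (Fin (N + 1)) (Fin (N + 1)) ℝ) (π : Fin (N + 1) → ℝ)
    {Ω : Type*} [MeasurableSpace Ω] (μ : Measure Ω) (X : ℕ → Ω → Fin (N + 1))
    (x : Fin (N + 1)) : Prop :=
  ∀ n : ℕ, tvDistAt P π n ≤ μ.real {ω | (n : WithTop ℕ) < hitTime X x ω}

/-- The state `[N/2] + 1` of `{0, …, N}`, for `N ≥ 1`. -/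
def xStar (N : ℕ) : Fin (N + 1) := Fin.ofNat (N + 1) (N / 2 + 1)

theorem xStar_val (N : ℕ) (hN : 1 ≤ N) : (xStar N : ℕ) = N / 2 + 1 := by
  simp only [xStar, Fin.val_ofNat]
  exact Nat.mod_eq_of_lt (by omega)

/-- The distances `d^{(N)}` have a cutoff at `t_N`. -/
def IsCutoff (d : ℕ → ℕ → ℝ) (t : ℕ → ℝ) : Prop :=
  (∀ c : ℝ, 1 < c → Tendsto (fun N => d N ⌊c * t N⌋₊) atTop (𝓝 0)) ∧
  (∀ c : ℝ, 0 ≤ c → c < 1 → Tendsto (fun N => d N ⌊c * t N⌋₊) atTop (𝓝 1))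

/-- The distances `d^{(N)}` have a cutoff at `t_N` with window `w_N = o(t_N)`. -/
def IsCutoffWithWindow (d : ℕ → ℕ → ℝ) (t w : ℕ → ℝ) : Prop :=
  w =o[atTop] t ∧
  Tendsto (fun γ : ℝ => liminf (fun N => d N ⌊t N - γ * w N⌋₊) atTop) atTop (𝓝 1) ∧
  Tendsto (fun γ : ℝ => limsup (fun N => d N ⌊t N + γ * w N⌋₊) atTop) atTop (𝓝 0)

/-- `∑_{k=1}^N 1 / (1 - λ_k)`. -/
def invGapSum (lam : ℕ → ℝ) (N : ℕ) : ℝ :=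
  ∑ k ∈ Finset.Icc 1 N, 1 / (1 - lam k)

/-- `∑_{k=1}^N λ_k / (1 - λ_k)²`. -/
def varSum (lam : ℕ → ℝ) (N : ℕ) : ℝ :=
  ∑ k ∈ Finset.Icc 1 N, lam k / (1 - lam k) ^ 2

end BDCutoff

end

/-! Write `τ = 1 / (1 - λ₁)`, `S` and `V` for the two spectral sums, `c` for the halting state, `u x
= E_x[T_c]` and `κ = E_π[T_c]`. The spectrum enters only through the deviation operator `D` (group
inverse of `I - P`): `tr D = S`, `tr D² = V + S`, and `D` has norm at most `τ` on `ℓ²(π)`.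

On a path both `D` and the Green operator of the chain killed at `c` have explicit kernels in terms
of edge resistances, and they differ only by terms in `u` and `κ` (`devKer_eq`). Killing at `c` cuts
the path in two; by symmetry the right piece mirrors the left piece of `c.rev`, and the first two
moments of `T_c` from `0` are traces over the left piece (`green_one_zero`,
`two_mul_green_green_zero`). Thus `S = E T_c + E T_{c.rev} - κ`, with an analogous identity for `V`
and the variances (`varSum_eq`).

Both sides of `c` carry mass at least `ε`. There `D` applied to the indicator of the left side is an
affine function of `u`, so the norm bound gives `κ = O(τ)` and `π(u²) = O(τ²)` (`meanGreen_le`,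
`sum_green_sq_le`). Hence `E T_c = S / 2 + O(τ)` and `V / 2 ≤ Var T_c ≤ V + O(τ²)`, while `V ≤ τ S`
and `τ = o(S)`.

The halting property and Chebyshev bound `d` from above. For the lower bound, well before `E T_c`
the chain is still far from `c`, in a set `{u > M}` of `π`-mass at most `κ / M`
(`surv_sub_le_tvDistAt`). `cutoff_of_tails` turns these bounds into the asymptotic statements. -/

namespace BDCutoff

/-! ### Reversibility, edge flows and resistances on a path. -/

section DetailedBalance

variable {N : ℕ} {P : Matrix (Fin (N + 1)) (Fin (N + 1)) ℝ} {π : Fin (N + 1) → ℝ}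

/-- The indicator of `x ≤ j`, for a state `x` and the edge `j` between `j` and `j + 1`. -/
def edgeInd (x : Fin (N + 1)) (j : Fin N) : ℝ := if x ≤ j.castSucc then 1 else 0

theorem edgeInd_eq_zero_or_one (x : Fin (N + 1)) (j : Fin N) :
    edgeInd x j = 0 ∨ edgeInd x j = 1 := by
  unfold edgeInd; split_ifs <;> simp

theorem edgeInd_nonneg (x : Fin (N + 1)) (j : Fin N) : 0 ≤ edgeInd x j := by
  unfold edgeInd; split_ifs <;> simp

theorem edgeInd_le_one (x : Fin (N + 1)) (j : Fin N) : edgeInd x j ≤ 1 := by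
  unfold edgeInd; split_ifs <;> simp

theorem edgeInd_mul_self (x : Fin (N + 1)) (j : Fin N) :
    edgeInd x j * edgeInd x j = edgeInd x j := by
  rcases edgeInd_eq_zero_or_one x j with h | h <;> simp [h]

theorem edgeInd_zero (j : Fin N) : edgeInd (0 : Fin (N + 1)) j = 1 := by
  simp [edgeInd]

theorem edgeInd_antitone {x y : Fin (N + 1)} (h : x ≤ y) (j : Fin N) :
    edgeInd y j ≤ edgeInd x j := by
  unfold edgeInd
  split_ifs with h1 h2 <;> first | simp | exact absurd (h.trans h1) h2

theorem edgeInd_mul_of_le {x y : Fin (N + 1)} (h : x ≤ y) (j : Fin N) :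
    edgeInd x j * edgeInd y j = edgeInd y j := by
  unfold edgeInd
  split_ifs with h1 h2 h2 <;> first | exact absurd (h.trans h2) h1 | simp

theorem edgeInd_castSucc_sub_succ (i j : Fin N) :
    edgeInd i.castSucc j - edgeInd i.succ j = if i = j then 1 else 0 := by
  simp only [edgeInd, Fin.le_def, Fin.val_castSucc, Fin.val_succ, Fin.ext_iff]
  split_ifs <;> first | omega | simp

theorem edgeInd_rev (x : Fin (N + 1)) (j : Fin N) : edgeInd x.rev j.rev = 1 - edgeInd x j := by
  simp only [edgeInd, Fin.le_def, Fin.val_castSucc, Fin.val_rev]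
  have := x.2
  have := j.2
  split_ifs <;> first | omega | simp

/-- The net outflow at `x` of the edge flow `φ`. -/
noncomputable def outflow (φ : Fin N → ℝ) (x : Fin (N + 1)) : ℝ :=
  ∑ j : Fin N, φ j * ((if x = j.castSucc then 1 else 0) - (if x = j.succ then 1 else 0))

theorem outflow_sub (φ ψ : Fin N → ℝ) (x : Fin (N + 1)) :
    outflow (fun j => φ j - ψ j) x = outflow φ x - outflow ψ x := by
  simp only [outflow, ← Finset.sum_sub_distrib]
  exact Finset.sum_congr rfl fun j _ => by ring

theorem outflow_sum {ι : Type*} (s : Finset ι) (a : ι → ℝ) (φ : ι → Fin N → ℝ) (x : Fin (N + 1)) :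
    outflow (fun j => ∑ i ∈ s, a i * φ i j) x = ∑ i ∈ s, a i * outflow (φ i) x := by
  simp only [outflow, Finset.sum_mul, Finset.mul_sum]
  rw [Finset.sum_comm]
  exact Finset.sum_congr rfl fun i _ => Finset.sum_congr rfl fun j _ => by ring

/-- A unit flow along all edges from `y` to `N` has its source at `y` and its sink at `N`. The sink
at `N` cancels in every difference of such flows. -/
theorem outflow_edgeInd (x y : Fin (N + 1)) :
    outflow (edgeInd y) x = (if x = y then 1 else 0) - (if x = Fin.last N then 1 else 0) := by
  have h1 := Fin.sum_univ_castSucc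
    (fun z : Fin (N + 1) => (if y ≤ z then (1 : ℝ) else 0) * (if x = z then 1 else 0))
  have h2 := Fin.sum_univ_succ
    (fun z : Fin (N + 1) => (if y < z then (1 : ℝ) else 0) * (if x = z then 1 else 0))
  have h3 : ∀ j : Fin N, (y < j.succ) = (y ≤ j.castSucc) := fun j => by
    rw [Fin.lt_def, Fin.le_def, Fin.val_succ, Fin.val_castSucc, Nat.lt_succ_iff]
  simp only [mul_ite, mul_one, mul_zero, Finset.sum_ite_eq, Finset.mem_univ, if_true, Fin.le_last,
    Fin.not_lt_zero, if_false, ite_self, zero_add, h3] at h1 h2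
  simp only [outflow, edgeInd, mul_sub, mul_ite, mul_one, mul_zero, Finset.sum_sub_distrib]
  rw [← h2]
  -- The point mass is a difference of two steps, matching the sums over left and right endpoints of
  -- edges.
  have h4 : (if x = y then (1 : ℝ) else 0) = (if y ≤ x then 1 else 0) - if y < x then 1 else 0 := by
    rcases lt_trichotomy x y with h | h | h
    · simp [h.ne, h.not_ge, h.not_gt]
    · simp [h]
    · simp [h.ne', h.le, h]
  rw [h4, h1]; ring

/-- A sum over the neighbours of `x`, written as a sum over edges. -/
theorem sum_neighbours (x : Fin (N + 1)) (a : Fin (N + 1) → ℝ) (hx : a x = 0)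
    (ha : ∀ y : Fin (N + 1), (x : ℕ) + 1 < y ∨ (y : ℕ) + 1 < x → a y = 0) :
    ∑ y, a y = ∑ j : Fin N, ((if x = j.castSucc then a j.succ else 0) +
      (if x = j.succ then a j.castSucc else 0)) := by
  have h0 : ∀ y, a y = (if (y : ℕ) = x + 1 then a y else 0) +
      (if (x : ℕ) = y + 1 then a y else 0) := by
    intro y
    rcases lt_trichotomy (x : ℕ) y with h | h | h
    · by_cases h1 : (y : ℕ) = x + 1
      · rw [if_pos h1, if_neg (by omega), add_zero]
      · rw [if_neg h1, if_neg (by omega), ha y (Or.inl (by omega)), add_zero]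
    · rw [if_neg (by omega), if_neg (by omega), ← Fin.ext h, hx, add_zero]
    · by_cases h1 : (x : ℕ) = y + 1
      · rw [if_pos h1, if_neg (by omega), zero_add]
      · rw [if_neg h1, if_neg (by omega), ha y (Or.inr (by omega)), add_zero]
  rw [Finset.sum_congr rfl fun y _ => h0 y, Finset.sum_add_distrib, Finset.sum_add_distrib]
  congr 1
  · rw [Fin.sum_univ_succ]
    rw [if_neg (by simp), zero_add]
    refine Finset.sum_congr rfl fun j _ => ?_
    simp only [Fin.val_succ, Fin.ext_iff, Fin.val_castSucc]
    split_ifs <;> first | rfl | omega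
  · rw [Fin.sum_univ_castSucc]
    have := x.2
    rw [if_neg (by rw [Fin.val_last]; omega), add_zero]
    refine Finset.sum_congr rfl fun j _ => ?_
    simp only [Fin.val_succ, Fin.ext_iff, Fin.val_castSucc]

/-- Stationarity says that the net current `A` has no divergence. Summed over the states up to `i`,
the divergence is the current through the single edge `i`, which therefore vanishes. -/
theorem IsStationary.detailed_balance_edge (hP : IsBirthDeath P) (hπ : IsStationary P π)
    (i : Fin N) :
    π i.castSucc * P i.castSucc i.succ = π i.succ * P i.succ i.castSucc := by
  set A : Fin (N + 1) → Fin (N + 1) → ℝ := fun x z => π x * P x z - π z * P z x with hA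
  have hrow : ∀ x, ∑ z, A x z = 0 := by
    intro x
    have h1 : ∑ z, π z * P z x = π x := congrFun hπ.invariant x
    simp only [hA, Finset.sum_sub_distrib, ← Finset.mul_sum, hP.row_sum, h1]
    ring
  have hrow' : ∀ x, ∑ j : Fin N, ((if x = j.castSucc then A j.castSucc j.succ else 0) -
      (if x = j.succ then A j.castSucc j.succ else 0)) = 0 := by
    intro x
    refine Eq.trans ?_ (hrow x)
    rw [sum_neighbours x (A x) (by simp [hA])
      (fun y hy => by simp [hA, hP.tridiagonal x y hy, hP.tridiagonal y x hy.symm])]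
    refine Finset.sum_congr rfl fun j _ => ?_
    split_ifs with h1 h2 h2
    · exact absurd (h1.symm.trans h2) (by simp [Fin.ext_iff])
    · simp [h1]
    · rw [h2]; simp [hA]
    · simp
  have h1 : ∑ x, edgeInd x i * ∑ j : Fin N, ((if x = j.castSucc then A j.castSucc j.succ else 0) -
      (if x = j.succ then A j.castSucc j.succ else 0)) = 0 := by
    simp [hrow']
  simp only [Finset.mul_sum] at h1
  rw [Finset.sum_comm] at h1
  have h2 : ∀ j : Fin N, ∑ x, edgeInd x i * ((if x = j.castSucc then A j.castSucc j.succ else 0) -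
      (if x = j.succ then A j.castSucc j.succ else 0)) =
      if j = i then A j.castSucc j.succ else 0 := by
    intro j
    simp only [mul_sub, mul_ite, mul_zero, Finset.sum_sub_distrib, Finset.sum_ite_eq',
      Finset.mem_univ, if_true]
    rw [← sub_mul, edgeInd_castSucc_sub_succ]
    simp
  simp only [h2, Finset.sum_ite_eq', Finset.mem_univ, if_true] at h1
  exact sub_eq_zero.1 h1

theorem IsStationary.detailed_balance (hP : IsBirthDeath P) (hπ : IsStationary P π)
    (x y : Fin (N + 1)) : π x * P x y = π y * P y x := by
  wlog h : x ≤ y generalizing x y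
  · exact (this y x (le_of_not_ge h)).symm
  rcases h.eq_or_lt with rfl | h
  · rfl
  by_cases h1 : (x : ℕ) + 1 = y
  · have hx : (x : ℕ) < N := by have := y.2; omega
    have := hπ.detailed_balance_edge hP ⟨x, hx⟩
    have e1 : (⟨x, hx⟩ : Fin N).castSucc = x := rfl
    have e2 : (⟨x, hx⟩ : Fin N).succ = y := Fin.ext h1
    rwa [e1, e2] at this
  · have h2 : (x : ℕ) + 1 < y := by have : (x : ℕ) < y := h; omega
    rw [hP.tridiagonal x y (Or.inl h2), hP.tridiagonal y x (Or.inr h2)]; simp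

theorem apply_eq_apply_zero_of_step {α : Type*} (f : Fin (N + 1) → α)
    (h : ∀ j : Fin N, f j.castSucc = f j.succ) (x : Fin (N + 1)) : f x = f 0 := by
  induction x using Fin.induction with
  | zero => rfl
  | succ j ih => rw [← h, ih]

/-- Detailed balance propagates a zero of `π` across every edge, which would make the total mass
zero. -/
theorem IsStationary.pos (hP : IsBirthDeath P) (hπ : IsStationary P π) (x : Fin (N + 1)) :
    0 < π x := by
  have h := apply_eq_apply_zero_of_step (fun x => π x = 0) (fun j => by
    have hb := hπ.detailed_balance_edge hP j
    have hu := hP.up_pos j.castSucc j.succ (by simp)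
    have hd := hP.down_pos j.castSucc j.succ (by simp)
    refine propext ⟨fun h0 => ?_, fun h0 => ?_⟩
    · rw [h0, zero_mul] at hb
      exact (mul_eq_zero.1 hb.symm).resolve_right hd.ne'
    · rw [h0, zero_mul] at hb
      exact (mul_eq_zero.1 hb).resolve_right hu.ne')
  refine lt_of_le_of_ne (hπ.nonneg x) fun hx => ?_
  have h0 : π 0 = 0 := (h x) ▸ hx.symm
  have hall : ∀ y, π y = 0 := fun y => (h y).symm ▸ h0
  have := hπ.sum_eq_one
  simp [hall] at this

/-- The ratio `π x.rev / π x` is the same at both ends of each edge, since an edge and its mirror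
image have the same transition probabilities. Total mass one forces the ratio to be one. -/
theorem IsStationary.rev_eq (hP : IsBirthDeath P) (hs : IsSymmetricChain P) (hπ : IsStationary P π)
    (x : Fin (N + 1)) : π x.rev = π x := by
  have h := apply_eq_apply_zero_of_step (fun x => π x.rev / π x) (fun j => by
    have hb := hπ.detailed_balance hP j.castSucc j.succ
    have hb' := hπ.detailed_balance hP j.castSucc.rev j.succ.rev
    rw [hs, hs] at hb'
    have hu := hP.up_pos j.castSucc j.succ (by simp)
    have hd := hP.down_pos j.castSucc j.succ (by simp)
    have h1 := hπ.pos hP j.castSucc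
    have h2 := hπ.pos hP j.succ
    rw [div_eq_div_iff h1.ne' h2.ne']
    have h3 : P j.castSucc j.succ * P j.succ j.castSucc ≠ 0 := (mul_pos hu hd).ne'
    apply mul_right_cancel₀ h3
    linear_combination π j.succ * P j.succ j.castSucc * hb' -
      π j.succ.rev * P j.succ j.castSucc * hb)
  have h1 : ∀ x, π x.rev = (π (Fin.rev 0) / π 0) * π x := fun x => by
    have := h x
    rw [← this, div_mul_cancel₀ _ (hπ.pos hP x).ne']
  have h2 : ∑ x : Fin (N + 1), π x.rev = 1 := by
    rw [← hπ.sum_eq_one]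
    exact Equiv.sum_comp Fin.revPerm π
  have h3 : π (Fin.rev 0) / π 0 = 1 := by
    rw [Finset.sum_congr rfl fun x _ => h1 x, ← Finset.mul_sum, hπ.sum_eq_one, mul_one] at h2
    exact h2
  rw [h1, h3, one_mul]

/-- The resistance of the edge `j`. -/
noncomputable def resistance (P : Matrix (Fin (N + 1)) (Fin (N + 1)) ℝ) (π : Fin (N + 1) → ℝ)
    (j : Fin N) : ℝ :=
  (π j.castSucc * P j.castSucc j.succ)⁻¹

/-- The distribution function of `π`. -/
noncomputable def cdf (π : Fin (N + 1) → ℝ) (j : Fin N) : ℝ := ∑ x, π x * edgeInd x j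

/-- The Laplacian `(I - P) f`. -/
noncomputable def lap (P : Matrix (Fin (N + 1)) (Fin (N + 1)) ℝ) (f : Fin (N + 1) → ℝ)
    (x : Fin (N + 1)) : ℝ :=
  f x - ∑ y, P x y * f y

theorem resistance_pos (hP : IsBirthDeath P) (hπ : IsStationary P π) (j : Fin N) :
    0 < resistance P π j :=
  inv_pos.2 (mul_pos (hπ.pos hP _) (hP.up_pos _ _ (by simp)))

theorem resistance_rev (hP : IsBirthDeath P) (hs : IsSymmetricChain P) (hπ : IsStationary P π)
    (j : Fin N) : resistance P π j.rev = resistance P π j := by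
  unfold resistance
  have e1 : j.rev.castSucc = j.succ.rev := (Fin.rev_succ j).symm
  have e2 : j.rev.succ = j.castSucc.rev := (Fin.rev_castSucc j).symm
  rw [e1, e2, hs, hπ.rev_eq hP hs, hπ.detailed_balance hP]

theorem cdf_nonneg (hπ : IsStationary P π) (j : Fin N) : 0 ≤ cdf π j :=
  Finset.sum_nonneg fun x _ => mul_nonneg (hπ.nonneg x) (edgeInd_nonneg x j)

/-- The product is the mean passage time from `j` to `j + 1`. The bound feeds the monotonicity of
the variance. -/
theorem one_le_resistance_mul_cdf (hP : IsBirthDeath P) (hπ : IsStationary P π) (j : Fin N) :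
    1 ≤ resistance P π j * cdf π j := by
  have hc : 0 < π j.castSucc * P j.castSucc j.succ :=
    mul_pos (hπ.pos hP _) (hP.up_pos _ _ (by simp))
  have h1 : P j.castSucc j.succ ≤ 1 := by
    rw [← hP.row_sum j.castSucc]
    exact Finset.single_le_sum (fun y _ => hP.nonneg _ y) (Finset.mem_univ _)
  have h2 : π j.castSucc ≤ cdf π j := by
    have := Finset.single_le_sum (f := fun x => π x * edgeInd x j)
      (fun x _ => mul_nonneg (hπ.nonneg x) (edgeInd_nonneg x j)) (Finset.mem_univ j.castSucc)
    simpa [edgeInd, cdf] using this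
  rw [resistance, inv_mul_eq_div, one_le_div hc]
  exact (mul_le_of_le_one_right (hπ.nonneg _) h1).trans h2

/-- Ohm's law: `hf` says that `φ` is the current of the potential `f`, and the reversible Laplacian
is its divergence. -/
theorem mul_lap (hP : IsBirthDeath P) (hπ : IsStationary P π) (f : Fin (N + 1) → ℝ)
    (φ : Fin N → ℝ) (hf : ∀ j : Fin N, f j.castSucc - f j.succ = resistance P π j * φ j)
    (x : Fin (N + 1)) : π x * lap P f x = outflow φ x := by
  have h1 : π x * lap P f x = ∑ y, π x * P x y * (f x - f y) := by
    simp only [mul_sub, Finset.sum_sub_distrib, lap, ← Finset.sum_mul, ← Finset.mul_sum, hP.row_sum,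
      one_mul, mul_assoc]
  rw [h1, sum_neighbours x _ (by simp) (fun y hy => by simp [hP.tridiagonal x y hy]), outflow]
  refine Finset.sum_congr rfl fun j _ => ?_
  have hc : π j.castSucc * P j.castSucc j.succ * resistance P π j = 1 :=
    mul_inv_cancel₀ (mul_pos (hπ.pos hP _) (hP.up_pos _ _ (by simp))).ne'
  have hj : π j.castSucc * P j.castSucc j.succ * (f j.castSucc - f j.succ) = φ j := by
    rw [hf, ← mul_assoc, hc, one_mul]
  split_ifs with h2 h3 h3
  · exact absurd (h2.symm.trans h3) (by simp [Fin.ext_iff])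
  · rw [h2, hj]; ring
  · rw [h3, ← hπ.detailed_balance hP]
    linear_combination - hj
  · simp

/-- The potential with flow `φ`, normalized by `a`. -/
theorem mul_lap_potential (hP : IsBirthDeath P) (hπ : IsStationary P π) (a φ : Fin N → ℝ)
    (x : Fin (N + 1)) :
    π x * lap P (fun x => ∑ j, resistance P π j * (edgeInd x j - a j) * φ j) x = outflow φ x := by
  refine mul_lap hP hπ _ φ (fun i => ?_) x
  rw [← Finset.sum_sub_distrib]
  have : ∀ j, resistance P π j * (edgeInd i.castSucc j - a j) * φ j -
      resistance P π j * (edgeInd i.succ j - a j) * φ j =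
      if i = j then resistance P π j * φ j else 0 := fun j => by
    have := edgeInd_castSucc_sub_succ i j
    rw [← mul_one (if i = j then resistance P π j * φ j else 0), ite_mul, zero_mul, mul_one]
    split_ifs at this ⊢ <;> linear_combination (resistance P π j * φ j) * this
  simp [this]

theorem outflow_cdf (hπ : IsStationary P π) (x : Fin (N + 1)) :
    outflow (cdf π) x = π x - if x = Fin.last N then 1 else 0 := by
  have := outflow_sum Finset.univ π (fun y => edgeInd y) x
  rw [show cdf π = fun j => ∑ i, π i * edgeInd i j from rfl, this]
  simp [outflow_edgeInd, mul_sub, hπ.sum_eq_one]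

theorem lap_selfAdjoint (hP : IsBirthDeath P) (hπ : IsStationary P π) (f g : Fin (N + 1) → ℝ) :
    ∑ y, π y * g y * lap P f y = ∑ y, π y * lap P g y * f y := by
  simp only [lap, mul_sub, sub_mul, Finset.sum_sub_distrib, Finset.mul_sum, Finset.sum_mul]
  congr 1
  rw [Finset.sum_comm]
  refine Finset.sum_congr rfl fun x _ => Finset.sum_congr rfl fun y _ => ?_
  linear_combination g y * f x * hπ.detailed_balance hP y x

end DetailedBalance

/-! ### Green and deviation kernels, and their traces. -/

section Kernels

variable {N : ℕ} {r : Fin N → ℝ} {π : Fin (N + 1) → ℝ}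

/-- The Green kernel, with respect to `π`, of the chain killed at `c`. -/
noncomputable def hitKer (r : Fin N → ℝ) (c x y : Fin (N + 1)) : ℝ :=
  ∑ j, r j * (edgeInd x j - edgeInd c j) * (edgeInd y j - edgeInd c j)

/-- The deviation kernel (the kernel of the group inverse of `I - P`) with respect to `π`. -/
noncomputable def devKer (r : Fin N → ℝ) (π : Fin (N + 1) → ℝ) (x y : Fin (N + 1)) : ℝ :=
  ∑ j, r j * (edgeInd x j - cdf π j) * (edgeInd y j - cdf π j)

/-- The part of `hitKer` to the left of `c`. -/
noncomputable def leftKer (r : Fin N → ℝ) (c x y : Fin (N + 1)) : ℝ :=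
  ∑ j, r j * (1 - edgeInd c j) * (edgeInd x j * edgeInd y j)

/-- The part of `hitKer` to the right of `c`. -/
noncomputable def rightKer (r : Fin N → ℝ) (c x y : Fin (N + 1)) : ℝ :=
  ∑ j, r j * edgeInd c j * ((1 - edgeInd x j) * (1 - edgeInd y j))

/-- The Green operator of the chain killed at `c`. -/
noncomputable def green (r : Fin N → ℝ) (π : Fin (N + 1) → ℝ) (c : Fin (N + 1))
    (g : Fin (N + 1) → ℝ) (x : Fin (N + 1)) : ℝ :=
  ∑ y, hitKer r c x y * (π y * g y)

/-- The trace of the Green operator to the left of `c`. -/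
noncomputable def leftTrace (r : Fin N → ℝ) (π : Fin (N + 1) → ℝ) (c : Fin (N + 1)) : ℝ :=
  ∑ x, π x * leftKer r c x x

/-- The trace of the square of the Green operator to the left of `c`. -/
noncomputable def leftTraceSq (r : Fin N → ℝ) (π : Fin (N + 1) → ℝ) (c : Fin (N + 1)) : ℝ :=
  ∑ x, ∑ y, π x * π y * leftKer r c x y ^ 2

/-- The mean, under `π`, of the hitting time of `c`. -/
noncomputable def meanGreen (r : Fin N → ℝ) (π : Fin (N + 1) → ℝ) (c : Fin (N + 1)) : ℝ :=
  ∑ j, r j * (cdf π j - edgeInd c j) ^ 2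

/-- For `e` equal to `0` or `1`, `(a - e)(b - e) = (1 - e) a b + e (1 - a)(1 - b)`: killing at `c`
disconnects the path. -/
theorem hitKer_eq_add (c x y : Fin (N + 1)) :
    hitKer r c x y = leftKer r c x y + rightKer r c x y := by
  simp only [hitKer, leftKer, rightKer, ← Finset.sum_add_distrib]
  refine Finset.sum_congr rfl fun j _ => ?_
  rcases edgeInd_eq_zero_or_one c j with h | h <;> rw [h] <;> ring

theorem leftKer_eq_zero {c x : Fin (N + 1)} (h : c ≤ x) (y : Fin (N + 1)) :
    leftKer r c x y = 0 :=
  Finset.sum_eq_zero fun j _ => by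
    linear_combination (-r j * edgeInd y j) * edgeInd_mul_of_le h j

theorem rightKer_eq_zero {c x : Fin (N + 1)} (h : x ≤ c) (y : Fin (N + 1)) :
    rightKer r c x y = 0 :=
  Finset.sum_eq_zero fun j _ => by
    linear_combination (-r j * (1 - edgeInd y j)) * edgeInd_mul_of_le h j

theorem hitKer_sq (c x y : Fin (N + 1)) :
    hitKer r c x y ^ 2 = leftKer r c x y ^ 2 + rightKer r c x y ^ 2 := by
  rw [hitKer_eq_add]
  rcases le_total x c with h | h
  · rw [rightKer_eq_zero h]; ring
  · rw [leftKer_eq_zero h]; ring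

theorem leftKer_symm (c x y : Fin (N + 1)) : leftKer r c x y = leftKer r c y x :=
  Finset.sum_congr rfl fun j _ => by ring

theorem hitKer_symm (c x y : Fin (N + 1)) : hitKer r c x y = hitKer r c y x :=
  Finset.sum_congr rfl fun j _ => by ring

theorem leftKer_nonneg (hr : ∀ j, 0 ≤ r j) (c x y : Fin (N + 1)) : 0 ≤ leftKer r c x y :=
  Finset.sum_nonneg fun j _ => mul_nonneg
    (mul_nonneg (hr j) (sub_nonneg.2 (edgeInd_le_one c j)))
    (mul_nonneg (edgeInd_nonneg x j) (edgeInd_nonneg y j))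

theorem hitKer_nonneg (hr : ∀ j, 0 ≤ r j) (c x y : Fin (N + 1)) : 0 ≤ hitKer r c x y := by
  rw [hitKer_eq_add]
  exact add_nonneg (leftKer_nonneg hr c x y) (Finset.sum_nonneg fun j _ => mul_nonneg
    (mul_nonneg (hr j) (edgeInd_nonneg c j))
    (mul_nonneg (sub_nonneg.2 (edgeInd_le_one x j)) (sub_nonneg.2 (edgeInd_le_one y j))))

theorem rightKer_eq_leftKer_rev (hr : ∀ j, r j.rev = r j) (c x y : Fin (N + 1)) :
    rightKer r c x y = leftKer r c.rev x.rev y.rev := by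
  unfold leftKer
  rw [← Equiv.sum_comp Fin.revPerm]
  refine Finset.sum_congr rfl fun j _ => ?_
  simp only [Fin.revPerm_apply, hr, edgeInd_rev]
  ring

theorem sum_rightKer (hr : ∀ j, r j.rev = r j) (hπ : ∀ x, π x.rev = π x) (c : Fin (N + 1)) :
    ∑ x, π x * rightKer r c x x = leftTrace r π c.rev := by
  unfold leftTrace
  rw [← Equiv.sum_comp Fin.revPerm]
  simp only [Fin.revPerm_apply, hπ, rightKer_eq_leftKer_rev hr, Fin.rev_rev]

theorem sum_rightKer_sq (hr : ∀ j, r j.rev = r j) (hπ : ∀ x, π x.rev = π x) (c : Fin (N + 1)) :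
    ∑ x, ∑ y, π x * π y * rightKer r c x y ^ 2 = leftTraceSq r π c.rev := by
  unfold leftTraceSq
  rw [← Equiv.sum_comp Fin.revPerm]
  refine Finset.sum_congr rfl fun x _ => ?_
  rw [← Equiv.sum_comp Fin.revPerm]
  simp only [Fin.revPerm_apply, hπ, rightKer_eq_leftKer_rev hr, Fin.rev_rev]

theorem sum_hitKer (hr : ∀ j, r j.rev = r j) (hπ : ∀ x, π x.rev = π x) (c : Fin (N + 1)) :
    ∑ x, π x * hitKer r c x x = leftTrace r π c + leftTrace r π c.rev := by
  simp only [hitKer_eq_add, mul_add, Finset.sum_add_distrib, sum_rightKer hr hπ, leftTrace]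

theorem sum_hitKer_sq (hr : ∀ j, r j.rev = r j) (hπ : ∀ x, π x.rev = π x) (c : Fin (N + 1)) :
    ∑ x, ∑ y, π x * π y * hitKer r c x y ^ 2 = leftTraceSq r π c + leftTraceSq r π c.rev := by
  simp only [hitKer_sq, mul_add, Finset.sum_add_distrib, sum_rightKer_sq hr hπ, leftTraceSq]

theorem sum_edge (hs : ∑ x, π x = 1) (a : ℝ) (j : Fin N) :
    ∑ x, π x * (edgeInd x j - a) = cdf π j - a := by
  simp only [mul_sub, Finset.sum_sub_distrib, ← Finset.sum_mul, hs, one_mul, cdf]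

theorem sum_kernel_mul (a : Fin N → ℝ) (b : Fin N → Fin (N + 1) → ℝ) (g : Fin (N + 1) → ℝ) :
    ∑ y, (∑ j, a j * b j y) * g y = ∑ j, a j * ∑ y, g y * b j y := by
  simp only [Finset.sum_mul, Finset.mul_sum]
  rw [Finset.sum_comm]
  exact Finset.sum_congr rfl fun j _ => Finset.sum_congr rfl fun y _ => by ring

theorem green_eq (c : Fin (N + 1)) (g : Fin (N + 1) → ℝ) (x : Fin (N + 1)) :
    green r π c g x = ∑ j, r j * (edgeInd x j - edgeInd c j) *
      ∑ y, π y * g y * (edgeInd y j - edgeInd c j) :=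
  sum_kernel_mul _ _ _

theorem green_one (hs : ∑ x, π x = 1) (c x : Fin (N + 1)) :
    green r π c 1 x = ∑ j, r j * (edgeInd x j - edgeInd c j) * (cdf π j - edgeInd c j) := by
  simp only [green_eq, Pi.one_apply, mul_one, sum_edge hs]

theorem sum_green_one (hs : ∑ x, π x = 1) (c : Fin (N + 1)) :
    ∑ x, π x * green r π c 1 x = meanGreen r π c := by
  have := sum_kernel_mul (fun j => r j * (cdf π j - edgeInd c j))
    (fun j x => edgeInd x j - edgeInd c j) π
  simp only [sum_edge hs] at this
  rw [meanGreen, Finset.sum_congr rfl fun j _ =>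
    show r j * (cdf π j - edgeInd c j) ^ 2 =
      r j * (cdf π j - edgeInd c j) * (cdf π j - edgeInd c j) by ring, ← this]
  refine Finset.sum_congr rfl fun x _ => ?_
  rw [green_one hs, mul_comm]
  congr 1
  exact Finset.sum_congr rfl fun j _ => by ring

/-- Edge by edge, substitute `a - F = (a - e) - (F - e)` in both factors. The deviation kernel is
thus a finite-rank perturbation of the killed Green kernel, controlled by hitting-time means. -/
theorem devKer_eq (hs : ∑ x, π x = 1) (c x y : Fin (N + 1)) :
    devKer r π x y = hitKer r c x y - green r π c 1 x - green r π c 1 y + meanGreen r π c := by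
  simp only [devKer, hitKer, green_one hs, meanGreen, ← Finset.sum_sub_distrib,
    ← Finset.sum_add_distrib]
  exact Finset.sum_congr rfl fun j _ => by ring

theorem sum_devKer (hr : ∀ j, r j.rev = r j) (hπ : ∀ x, π x.rev = π x) (hs : ∑ x, π x = 1)
    (c : Fin (N + 1)) :
    ∑ x, π x * devKer r π x x = leftTrace r π c + leftTrace r π c.rev - meanGreen r π c := by
  have h : ∀ x, π x * devKer r π x x = π x * hitKer r c x x -
      2 * (π x * green r π c 1 x) + π x * meanGreen r π c := fun x => by
    rw [devKer_eq hs c]; ring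
  simp only [h, Finset.sum_add_distrib, Finset.sum_sub_distrib, ← Finset.mul_sum, ← Finset.sum_mul,
    sum_hitKer hr hπ, sum_green_one hs, hs]
  ring

/-- After expanding the square via `devKer_eq`, all cross terms collapse, since the Green kernel
integrates to `u` in either variable and `u` integrates to `κ`. -/
theorem sum_devKer_sq (hr : ∀ j, r j.rev = r j) (hπ : ∀ x, π x.rev = π x) (hs : ∑ x, π x = 1)
    (c : Fin (N + 1)) :
    ∑ x, ∑ y, π x * π y * devKer r π x y ^ 2 = leftTraceSq r π c + leftTraceSq r π c.rev -
      2 * ∑ x, π x * green r π c 1 x ^ 2 + meanGreen r π c ^ 2 := by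
  set u := green r π c 1 with hu
  set κ := meanGreen r π c with hκ
  have hrow : ∀ x, ∑ y, π y * hitKer r c x y = u x := fun x => by
    simp only [hu, green, Pi.one_apply, mul_one, mul_comm]
  have hmean : ∑ x, π x * u x = κ := sum_green_one hs c
  have h : ∀ x, ∑ y, π x * π y * devKer r π x y ^ 2 =
      ∑ y, π x * π y * hitKer r c x y ^ 2 - 2 * (π x * u x ^ 2)
      - 2 * ∑ y, π y * u y * (π x * hitKer r c x y)
      + 2 * κ * (π x * u x) + π x * (u x ^ 2 + ∑ y, π y * u y ^ 2 + κ ^ 2 + 2 * (u x * κ)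
      - 2 * (u x * κ) - 2 * κ ^ 2) := fun x => by
    have e : ∀ y, π x * π y * devKer r π x y ^ 2 = π x * π y * hitKer r c x y ^ 2
        - 2 * (π x * u x) * (π y * hitKer r c x y) - 2 * (π y * u y * (π x * hitKer r c x y))
        + 2 * κ * π x * (π y * hitKer r c x y)
        + π x * (u x ^ 2 + κ ^ 2 - 2 * (u x * κ)) * π y + π x * (π y * u y ^ 2)
        + 2 * (π x * u x - π x * κ) * (π y * u y) := fun y => by
      rw [devKer_eq hs c, ← hu, ← hκ]; ring
    simp only [e, Finset.sum_add_distrib, Finset.sum_sub_distrib, ← Finset.mul_sum, hrow, hmean,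
      hs]
    ring
  have hcol : ∑ x, ∑ y, π y * u y * (π x * hitKer r c x y) = ∑ y, π y * u y ^ 2 := by
    rw [Finset.sum_comm]
    refine Finset.sum_congr rfl fun y _ => ?_
    rw [← Finset.mul_sum, Finset.sum_congr rfl fun x _ => by rw [hitKer_symm], hrow]; ring
  simp only [h, Finset.sum_add_distrib, Finset.sum_sub_distrib, ← Finset.mul_sum, hcol,
    sum_hitKer_sq hr hπ, mul_add, mul_sub, ← Finset.sum_mul, hs, hmean]
  ring

theorem leftTrace_eq (c : Fin (N + 1)) :
    leftTrace r π c = ∑ j, r j * (1 - edgeInd c j) * cdf π j := by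
  have := sum_kernel_mul (fun j => r j * (1 - edgeInd c j)) (fun j x => edgeInd x j) π
  simp only [leftTrace, leftKer, edgeInd_mul_self, cdf]
  rw [← this]
  exact Finset.sum_congr rfl fun x _ => mul_comm _ _

theorem green_one_zero (hs : ∑ x, π x = 1) (c : Fin (N + 1)) :
    green r π c 1 0 = leftTrace r π c := by
  rw [green_one hs, leftTrace_eq]
  refine Finset.sum_congr rfl fun j _ => ?_
  rw [edgeInd_zero]
  linear_combination r j * edgeInd_mul_self c j

/-- Starting from `0`, the chain must pass through `y < c` before reaching `c`, so it makes as many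
visits to `y` as from `y` itself; for `y ≥ c` both sides vanish. -/
theorem hitKer_zero (c y : Fin (N + 1)) : hitKer r c 0 y = leftKer r c y y := by
  rw [hitKer_eq_add, rightKer_eq_zero (Fin.zero_le c), add_zero]
  exact Finset.sum_congr rfl fun j _ => by rw [edgeInd_zero, edgeInd_mul_self, one_mul]

theorem leftKer_of_le {x y : Fin (N + 1)} (c : Fin (N + 1)) (h : x ≤ y) :
    leftKer r c x y = leftKer r c y y :=
  Finset.sum_congr rfl fun j _ => by rw [edgeInd_mul_of_le h, edgeInd_mul_self]

theorem leftKer_diag_mul_hitKer (c y z : Fin (N + 1)) :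
    leftKer r c y y * hitKer r c y z = leftKer r c y y * leftKer r c y z := by
  rcases le_total y c with h | h
  · rw [hitKer_eq_add, rightKer_eq_zero h, add_zero]
  · rw [leftKer_eq_zero h]; ring

/-- With `k = leftKer`, the left side is the symmetrised sum of `(k y y + k z z) k y z`. For `y ≤ z`
one has `k y z = k z z`, which turns this into `k y y * k z z + (k y z)²`. This is what expresses
the variance of the hitting time through traces. -/
theorem two_mul_green_green_zero (c : Fin (N + 1)) :
    2 * green r π c (green r π c 1) 0 = leftTrace r π c ^ 2 + leftTraceSq r π c := by
  have h1 : green r π c (green r π c 1) 0 =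
      ∑ y, ∑ z, π y * π z * (leftKer r c y y * leftKer r c y z) := by
    simp only [green, hitKer_zero, Pi.one_apply, mul_one, Finset.mul_sum]
    refine Finset.sum_congr rfl fun y _ => Finset.sum_congr rfl fun z _ => ?_
    linear_combination π y * π z * leftKer_diag_mul_hitKer (r := r) c y z
  have h2 : green r π c (green r π c 1) 0 =
      ∑ y, ∑ z, π y * π z * (leftKer r c z z * leftKer r c y z) := by
    rw [h1, Finset.sum_comm]
    refine Finset.sum_congr rfl fun y _ => Finset.sum_congr rfl fun z _ => ?_
    rw [leftKer_symm c z y]; ring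
  rw [two_mul]
  nth_rewrite 1 [h1]
  rw [h2, leftTrace, sq, Finset.sum_mul_sum, leftTraceSq]
  simp only [← Finset.sum_add_distrib]
  refine Finset.sum_congr rfl fun y _ => Finset.sum_congr rfl fun z _ => ?_
  rcases le_total y z with h | h
  · rw [leftKer_of_le c h]; ring
  · rw [leftKer_symm c y z, leftKer_of_le c h]; ring

/-- Moving `c` across the edge `i` adds a rank-one kernel. The trace grows by `ρ = r i * cdf π i`,
the trace of the square by at least `ρ²` because the cross term is nonnegative, and `ρ² ≥ ρ` since
`ρ ≥ 1`. -/
theorem leftVar_mono (hr : ∀ j, 0 ≤ r j) (hπ : ∀ x, 0 ≤ π x) (h1 : ∀ j, 1 ≤ r j * cdf π j) :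
    Monotone fun c => leftTraceSq r π c - leftTrace r π c := by
  refine Fin.monotone_iff_le_succ.2 fun i => ?_
  have hk : ∀ x y, leftKer r i.succ x y =
      leftKer r i.castSucc x y + r i * (edgeInd x i * edgeInd y i) := fun x y => by
    have : ∀ j, r j * (1 - edgeInd i.succ j) * (edgeInd x j * edgeInd y j) =
        r j * (1 - edgeInd i.castSucc j) * (edgeInd x j * edgeInd y j) +
        if i = j then r j * (edgeInd x j * edgeInd y j) else 0 := fun j => by
      have := edgeInd_castSucc_sub_succ i j
      split_ifs at this ⊢ <;> linear_combination (r j * (edgeInd x j * edgeInd y j)) * this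
    simp [leftKer, this, Finset.sum_add_distrib]
  have hT : leftTrace r π i.succ = leftTrace r π i.castSucc + r i * cdf π i := by
    simp only [leftTrace, hk, mul_add, Finset.sum_add_distrib, edgeInd_mul_self, cdf,
      Finset.mul_sum]
    congr 1
    exact Finset.sum_congr rfl fun x _ => by ring
  have hQ : leftTraceSq r π i.castSucc + (r i * cdf π i) ^ 2 ≤ leftTraceSq r π i.succ := by
    have : (r i * cdf π i) ^ 2 =
        ∑ x, ∑ y, π x * π y * (r i * (edgeInd x i * edgeInd y i)) ^ 2 := by
      rw [mul_pow, sq (cdf π i), cdf, Finset.sum_mul_sum]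
      simp only [Finset.mul_sum]
      refine Finset.sum_congr rfl fun x _ => Finset.sum_congr rfl fun y _ => ?_
      rw [mul_pow, mul_pow, sq (edgeInd x i), sq (edgeInd y i), edgeInd_mul_self,
        edgeInd_mul_self]; ring
    rw [this, leftTraceSq, leftTraceSq]
    simp only [← Finset.sum_add_distrib, hk]
    refine Finset.sum_le_sum fun x _ => Finset.sum_le_sum fun y _ => ?_
    rw [← mul_add]
    refine mul_le_mul_of_nonneg_left ?_ (mul_nonneg (hπ x) (hπ y))
    nlinarith [mul_nonneg (leftKer_nonneg hr i.castSucc x y)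
      (mul_nonneg (hr i) (mul_nonneg (edgeInd_nonneg x i) (edgeInd_nonneg y i)))]
  nlinarith [h1 i]

theorem leftTrace_mono (hr : ∀ j, 0 ≤ r j) (hF : ∀ j, 0 ≤ cdf π j) {b c : Fin (N + 1)}
    (h : b ≤ c) : leftTrace r π b ≤ leftTrace r π c := by
  rw [leftTrace_eq, leftTrace_eq]
  exact Finset.sum_le_sum fun j _ => mul_le_mul_of_nonneg_right
    (mul_le_mul_of_nonneg_left (by linarith [edgeInd_antitone h j]) (hr j)) (hF j)

theorem meanGreen_nonneg (hr : ∀ j, 0 ≤ r j) (c : Fin (N + 1)) : 0 ≤ meanGreen r π c :=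
  Finset.sum_nonneg fun j _ => mul_nonneg (hr j) (sq_nonneg _)

/-- Only edges between `b` and `c` contribute. There `cdf π j ≥ ε`, so `r j * cdf π j` is at most `1
/ ε` times the corresponding term of `meanGreen`. -/
theorem leftTrace_sub_le (hr : ∀ j, 0 ≤ r j) {ε : ℝ} (hε : 0 < ε) {b c : Fin (N + 1)} (h : b ≤ c)
    (hF : ∀ j : Fin N, b ≤ j.castSucc → ε ≤ cdf π j) :
    leftTrace r π c - leftTrace r π b ≤ meanGreen r π c / ε := by
  rw [leftTrace_eq, leftTrace_eq, ← Finset.sum_sub_distrib, le_div_iff₀ hε, Finset.sum_mul]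
  refine Finset.sum_le_sum fun j _ => ?_
  by_cases hb : b ≤ j.castSucc
  · have hj := hF j hb
    by_cases hc : c ≤ j.castSucc
    · have e1 : edgeInd b j = 1 := if_pos hb
      have e2 : edgeInd c j = 1 := if_pos hc
      rw [e1, e2]
      simpa using mul_nonneg (hr j) (sq_nonneg (cdf π j - 1))
    · have e1 : edgeInd b j = 1 := if_pos hb
      have e2 : edgeInd c j = 0 := if_neg hc
      rw [e1, e2]
      nlinarith [mul_nonneg (mul_nonneg (hr j) (hε.le.trans hj)) (sub_nonneg.2 hj)]
  · have hc : ¬ c ≤ j.castSucc := fun hc => hb (h.trans hc)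
    have e1 : edgeInd b j = 0 := if_neg hb
    have e2 : edgeInd c j = 0 := if_neg hc
    rw [e1, e2]
    simpa using mul_nonneg (hr j) (sq_nonneg (cdf π j))

end Kernels

/-! ### The deviation operator as group inverse: trace formulas and norm. -/

section Spectral

variable {N : ℕ} {P : Matrix (Fin (N + 1)) (Fin (N + 1)) ℝ} {π : Fin (N + 1) → ℝ}

/-- The potential carries the flow with sources `π y * g y` and its only sink at `c`, so away from
`c` its divergence is the source term. -/
theorem lap_green (hP : IsBirthDeath P) (hπ : IsStationary P π) {c x : Fin (N + 1)} (h : x ≠ c)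
    (g : Fin (N + 1) → ℝ) : lap P (green (resistance P π) π c g) x = g x := by
  have h1 := mul_lap_potential hP hπ (edgeInd c)
    (fun j => ∑ y, π y * g y * (edgeInd y j - edgeInd c j)) x
  simp only [← green_eq] at h1
  rw [outflow_sum Finset.univ (fun y => π y * g y) (fun y j => edgeInd y j - edgeInd c j)] at h1
  simp only [outflow_sub, outflow_edgeInd, if_neg h, zero_sub, sub_neg_eq_add,
    sub_add_cancel, mul_ite, mul_one, mul_zero, Finset.sum_ite_eq, Finset.mem_univ, if_true] at h1
  exact mul_left_cancel₀ (hπ.pos hP x).ne' h1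

theorem green_self {r : Fin N → ℝ} (c : Fin (N + 1)) (g : Fin (N + 1) → ℝ) :
    green r π c g c = 0 := by
  simp [green_eq]

theorem green_nonneg {r : Fin N → ℝ} (hr : ∀ j, 0 ≤ r j) (hπ : ∀ x, 0 ≤ π x) (c : Fin (N + 1))
    {g : Fin (N + 1) → ℝ} (hg : ∀ x, 0 ≤ g x) (x : Fin (N + 1)) : 0 ≤ green r π c g x :=
  Finset.sum_nonneg fun y _ => mul_nonneg (hitKer_nonneg hr c x y) (mul_nonneg (hπ y) (hg y))

/-- The deviation operator, the group inverse of `I - P`. -/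
noncomputable def devMatrix (P : Matrix (Fin (N + 1)) (Fin (N + 1)) ℝ) (π : Fin (N + 1) → ℝ) :
    Matrix (Fin (N + 1)) (Fin (N + 1)) ℝ :=
  fun x y => devKer (resistance P π) π x y * π y

theorem devKer_symm {r : Fin N → ℝ} (x y : Fin (N + 1)) : devKer r π x y = devKer r π y x :=
  Finset.sum_congr rfl fun j _ => by ring

/-- The flow `edgeInd x - cdf π` injects unit mass at `x` and removes it according to `π`; the sinks
at `N` cancel. -/
theorem mul_lap_devKer (hP : IsBirthDeath P) (hπ : IsStationary P π) (x y : Fin (N + 1)) :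
    π y * lap P (devKer (resistance P π) π x) y = (if x = y then 1 else 0) - π y := by
  have h1 := mul_lap_potential hP hπ (cdf π) (fun j => edgeInd x j - cdf π j) y
  rw [show devKer (resistance P π) π x = fun y => devKer (resistance P π) π y x from
    funext fun y => devKer_symm x y, show (fun y => devKer (resistance P π) π y x) = fun y =>
    ∑ j, resistance P π j * (edgeInd y j - cdf π j) * (edgeInd x j - cdf π j) from rfl, h1,
    outflow_sub, outflow_edgeInd, outflow_cdf hπ]
  simp only [eq_comm (a := x)]
  ring

theorem sum_devMatrix_mul_lap (hP : IsBirthDeath P) (hπ : IsStationary P π)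
    (f : Fin (N + 1) → ℝ) (x : Fin (N + 1)) :
    ∑ y, devMatrix P π x y * lap P f y = f x - ∑ y, π y * f y := by
  have h := lap_selfAdjoint hP hπ f (devKer (resistance P π) π x)
  have h2 : ∑ y, π y * lap P (devKer (resistance P π) π x) y * f y = f x - ∑ y, π y * f y := by
    simp [mul_lap_devKer hP hπ, sub_mul]
  rw [← h2, ← h]
  exact Finset.sum_congr rfl fun y _ => by rw [devMatrix]; ring

theorem devMatrix_mulVec_one (hπ : IsStationary P π) (x : Fin (N + 1)) :
    ∑ y, devMatrix P π x y = 0 := by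
  have := sum_kernel_mul (fun j => resistance P π j * (edgeInd x j - cdf π j))
    (fun j y => edgeInd y j - cdf π j) π
  simp only [sum_edge hπ.sum_eq_one, sub_self, mul_zero, Finset.sum_const_zero] at this
  exact this

/-- Eigenvectors of `P` for the eigenvalues `lam 0, …, lam N`. -/
theorem IsSpectrumEnum.exists_eigenvectors {lam : ℕ → ℝ} (h : IsSpectrumEnum P lam) :
    ∃ f : Fin (N + 1) → Fin (N + 1) → ℝ, LinearIndependent ℝ f ∧ (∀ k, f k ≠ 0) ∧
      ∀ k x, ∑ y, P x y * f k y = lam k * f k x := by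
  have hev : ∀ k : Fin (N + 1), ∃ v, Module.End.HasEigenvector (Matrix.toLin' P) (lam k) v := by
    intro k
    refine Module.End.HasEigenvalue.exists_hasEigenvector
      (Module.End.hasEigenvalue_iff_mem_spectrum.2 ?_)
    rw [Matrix.spectrum_toLin', h.spectrum_eq]
    exact ⟨k, Nat.lt_succ_iff.1 k.2, rfl⟩
  choose f hf using hev
  refine ⟨f, Module.End.eigenvectors_linearIndependent' (Matrix.toLin' P) (fun k : Fin (N + 1) => lam k) ?_ f
      hf,
    fun k => (hf k).2, fun k x => ?_⟩
  · intro a b hab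
    exact Fin.ext (h.strictAnti.injOn (Nat.lt_succ_iff.1 a.2) (Nat.lt_succ_iff.1 b.2) hab)
  · have := congrFun (hf k).apply_eq_smul x
    simpa [Matrix.mulVec, dotProduct] using this

theorem abs_eigenvalue_le_one (hP : IsBirthDeath P) {l : ℝ} {f : Fin (N + 1) → ℝ} (hf : f ≠ 0)
    (h : ∀ x, ∑ y, P x y * f y = l * f x) : |l| ≤ 1 := by
  obtain ⟨x, -, hx⟩ := Finset.exists_max_image Finset.univ (fun x => |f x|) ⟨0, Finset.mem_univ _⟩
  have hpos : 0 < |f x| := by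
    obtain ⟨y, hy⟩ := Function.ne_iff.1 hf
    exact (abs_pos.2 hy).trans_le (hx y (Finset.mem_univ y))
  have : |l| * |f x| ≤ 1 * |f x| := by
    rw [← abs_mul, ← h, ← hP.row_sum x, Finset.sum_mul]
    refine (Finset.abs_sum_le_sum_abs _ _).trans (Finset.sum_le_sum fun y _ => ?_)
    rw [abs_mul, abs_of_nonneg (hP.nonneg x y)]
    exact mul_le_mul_of_nonneg_left (hx y (Finset.mem_univ y)) (hP.nonneg x y)
  exact le_of_mul_le_mul_right this hpos

theorem IsSpectrumEnum.abs_le_one {lam : ℕ → ℝ} (hP : IsBirthDeath P) (h : IsSpectrumEnum P lam)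
    {k : ℕ} (hk : k ≤ N) : |lam k| ≤ 1 := by
  obtain ⟨f, -, hf0, hf⟩ := h.exists_eigenvectors
  exact abs_eigenvalue_le_one hP (hf0 ⟨k, Nat.lt_succ_iff.2 hk⟩) (hf ⟨k, Nat.lt_succ_iff.2 hk⟩)

theorem IsSpectrumEnum.zero_eq_one {lam : ℕ → ℝ} (hP : IsBirthDeath P)
    (h : IsSpectrumEnum P lam) : lam 0 = 1 := by
  have h1 : (1 : ℝ) ∈ spectrum ℝ P := by
    rw [← Matrix.spectrum_toLin']
    refine Module.End.HasEigenvalue.mem_spectrum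
      (Module.End.hasEigenvalue_of_hasEigenvector (x := fun _ => 1) ⟨?_, ?_⟩)
    · rw [Module.End.mem_eigenspace_iff]
      ext x
      simp [Matrix.mulVec, dotProduct, hP.row_sum]
    · exact Function.ne_iff.2 ⟨0, one_ne_zero⟩
  rw [h.spectrum_eq] at h1
  obtain ⟨k, hk, hk1⟩ := h1
  have h2 : lam k ≤ lam 0 := h.strictAnti.antitoneOn (Set.mem_Iic.2 (Nat.zero_le N)) hk
    (Nat.zero_le k)
  exact le_antisymm (abs_le.1 (h.abs_le_one hP (Nat.zero_le N))).2 (hk1 ▸ h2)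

theorem IsSpectrumEnum.lt_one {lam : ℕ → ℝ} (hP : IsBirthDeath P)
    (h : IsSpectrumEnum P lam) {k : ℕ} (hk : 1 ≤ k) (hkN : k ≤ N) : lam k < 1 := by
  rw [← h.zero_eq_one hP]
  exact h.strictAnti (Set.mem_Iic.2 (Nat.zero_le N)) hkN hk

/-- The eigenvalues of the deviation operator. -/
noncomputable def devEigenvalue (lam : ℕ → ℝ) (k : ℕ) : ℝ := if k = 0 then 0 else 1 / (1 - lam k)

/-- Apply `D (I - P) f = f - π(f)`. For `k = 0` it makes `f` constant, and `D` kills constants; for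
`k > 0` pairing with `1` gives `π(f) = 0`, so `D` inverts `1 - lam k`. -/
theorem devMatrix_eigenvector (hP : IsBirthDeath P) (hπ : IsStationary P π) {lam : ℕ → ℝ}
    (h : IsSpectrumEnum P lam) {k : ℕ} (hk : k ≤ N) {f : Fin (N + 1) → ℝ}
    (hf : ∀ x, ∑ y, P x y * f y = lam k * f x) (x : Fin (N + 1)) :
    ∑ y, devMatrix P π x y * f y = devEigenvalue lam k * f x := by
  have hlap : ∀ y, lap P f y = (1 - lam k) * f y := fun y => by rw [lap, hf]; ring
  have h1 := sum_devMatrix_mul_lap hP hπ f x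
  unfold devEigenvalue
  split_ifs with h0
  · subst h0
    simp only [hlap, h.zero_eq_one hP, sub_self, zero_mul, mul_zero, Finset.sum_const_zero] at h1
    have hconst : ∀ y, f y = ∑ y, π y * f y := fun y => by
      have h1 := sum_devMatrix_mul_lap hP hπ f y
      simp only [hlap, h.zero_eq_one hP, sub_self, zero_mul, mul_zero,
        Finset.sum_const_zero] at h1
      linarith
    rw [Finset.sum_congr rfl fun y _ => by rw [hconst y], ← Finset.sum_mul,
      devMatrix_mulVec_one hπ]
    ring
  · have hne : 1 - lam k ≠ 0 :=
      (sub_pos.2 (h.lt_one hP (Nat.one_le_iff_ne_zero.2 h0) hk)).ne'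
    have hmean : ∑ y, π y * f y = 0 := by
      have h2 := lap_selfAdjoint hP hπ f 1
      have h3 : ∀ y, lap P 1 y = 0 := fun y => by simp [lap, hP.row_sum]
      simp only [h3, hlap, Pi.one_apply, mul_one, mul_zero, zero_mul, Finset.sum_const_zero] at h2
      have h4 : (1 - lam k) * ∑ y, π y * f y = 0 := by
        rw [← h2, Finset.mul_sum]
        exact Finset.sum_congr rfl fun y _ => by ring
      exact (mul_eq_zero.1 h4).resolve_left hne
    rw [hmean, sub_zero] at h1
    rw [← h1, Finset.mul_sum]
    refine Finset.sum_congr rfl fun y _ => ?_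
    rw [hlap]; field_simp

theorem trace_eq_sum_of_eigenvectors {n : Type*} [Fintype n] [DecidableEq n] (M : Matrix n n ℝ)
    {f : n → n → ℝ} (hf : LinearIndependent ℝ f) {a : n → ℝ}
    (h : ∀ k x, ∑ y, M x y * f k y = a k * f k x) : M.trace = ∑ k, a k := by
  set F : Matrix n n ℝ := Matrix.of f with hF
  have hu : IsUnit F.transpose := by
    rw [Matrix.isUnit_transpose, ← Matrix.linearIndependent_rows_iff_isUnit]
    exact hf
  have hMF : M * F.transpose = F.transpose * Matrix.diagonal a := by
    ext x k
    rw [Matrix.mul_diagonal, Matrix.mul_apply]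
    simpa [hF, mul_comm] using h k x
  obtain ⟨G, hG⟩ := hu
  have : M = G.val * Matrix.diagonal a * G.inv := by
    rw [hG, ← hMF, mul_assoc, ← hG, Units.inv_eq_val_inv, Units.mul_inv, mul_one]
  rw [this, Matrix.trace_mul_comm, ← mul_assoc, Units.inv_eq_val_inv, Units.inv_mul, one_mul,
    Matrix.trace_diagonal]

theorem sum_devEigenvalue (lam : ℕ → ℝ) (N : ℕ) (e : ℕ) (he : e ≠ 0) :
    ∑ k : Fin (N + 1), devEigenvalue lam k ^ e =
      ∑ k ∈ Finset.Icc 1 N, (1 / (1 - lam k)) ^ e := by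
  rw [Fin.sum_univ_eq_sum_range (fun k => devEigenvalue lam k ^ e)]
  induction N with
  | zero => simp [devEigenvalue, he]
  | succ N ih =>
    rw [Finset.sum_range_succ, ih, Finset.sum_Icc_succ_top (by omega), devEigenvalue,
      if_neg N.succ_ne_zero]

theorem invGapSum_eq (hP : IsBirthDeath P) (hπ : IsStationary P π) {lam : ℕ → ℝ}
    (h : IsSpectrumEnum P lam) :
    invGapSum lam N = ∑ x, π x * devKer (resistance P π) π x x := by
  obtain ⟨f, hli, -, hf⟩ := h.exists_eigenvectors
  have := trace_eq_sum_of_eigenvectors (devMatrix P π) hli (a := fun k => devEigenvalue lam k)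
    fun k x => devMatrix_eigenvector hP hπ h (Nat.lt_succ_iff.1 k.2) (hf k) x
  have h2 := sum_devEigenvalue lam N 1 one_ne_zero
  simp only [pow_one] at h2
  rw [invGapSum, ← h2, ← this, Matrix.trace]
  exact Finset.sum_congr rfl fun x _ => mul_comm _ _

/-- Both sides are `tr D²`, because `λ / (1 - λ)² + 1 / (1 - λ) = 1 / (1 - λ)²`. -/
theorem varSum_add_invGapSum (hP : IsBirthDeath P) (hπ : IsStationary P π) {lam : ℕ → ℝ}
    (h : IsSpectrumEnum P lam) :
    varSum lam N + invGapSum lam N =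
      ∑ x, ∑ y, π x * π y * devKer (resistance P π) π x y ^ 2 := by
  obtain ⟨f, hli, -, hf⟩ := h.exists_eigenvectors
  have hD := fun k x => devMatrix_eigenvector hP hπ h (Nat.lt_succ_iff.1 (Fin.is_lt k)) (hf k) x
  have := trace_eq_sum_of_eigenvectors (devMatrix P π * devMatrix P π) hli
    (a := fun k => devEigenvalue lam k ^ 2) fun k x => by
      simp only [Matrix.mul_apply, Finset.sum_mul]
      rw [Finset.sum_comm]
      simp only [mul_assoc, ← Finset.mul_sum, hD]
      rw [Finset.sum_congr rfl fun y _ => by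
        rw [show devMatrix P π x y * (devEigenvalue lam k * f k y) =
          devEigenvalue lam k * (devMatrix P π x y * f k y) by ring], ← Finset.mul_sum, hD]
      ring
  have h2 := sum_devEigenvalue lam N 2 two_ne_zero
  have h3 : varSum lam N + invGapSum lam N = ∑ k ∈ Finset.Icc 1 N, (1 / (1 - lam k)) ^ 2 := by
    rw [varSum, invGapSum, ← Finset.sum_add_distrib]
    refine Finset.sum_congr rfl fun k hk => ?_
    obtain ⟨hk1, hk2⟩ := Finset.mem_Icc.1 hk
    have hne : 1 - lam k ≠ 0 := (sub_pos.2 (h.lt_one hP hk1 hk2)).ne'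
    field_simp
    ring
  rw [h3, ← h2, ← this, Matrix.trace]
  simp only [Matrix.diag_apply, Matrix.mul_apply, devMatrix]
  refine Finset.sum_congr rfl fun x _ => Finset.sum_congr rfl fun y _ => ?_
  rw [devKer_symm y x]; ring

theorem eigenvectors_orthogonal (hP : IsBirthDeath P) (hπ : IsStationary P π) {a b : ℝ}
    (hab : a ≠ b) {f g : Fin (N + 1) → ℝ} (hf : ∀ x, ∑ y, P x y * f y = a * f x)
    (hg : ∀ x, ∑ y, P x y * g y = b * g x) : ∑ y, π y * (f y * g y) = 0 := by
  have h := lap_selfAdjoint hP hπ f g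
  have h1 : (a - b) * ∑ y, π y * (f y * g y) = 0 := by
    simp only [lap, hf, hg] at h
    rw [← sub_eq_zero, ← Finset.sum_sub_distrib] at h
    rw [Finset.mul_sum, ← neg_eq_zero, ← h, ← Finset.sum_neg_distrib]
    exact Finset.sum_congr rfl fun y _ => by ring
  exact (mul_eq_zero.1 h1).resolve_left (sub_ne_zero.2 hab)

theorem sum_sq_expansion {n : Type*} [Fintype n] [DecidableEq n] {w : n → ℝ} {f : n → n → ℝ}
    (horth : ∀ j k, j ≠ k → ∑ y, w y * (f j y * f k y) = 0) (b : n → ℝ) :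
    ∑ y, w y * (∑ k, b k * f k y) ^ 2 = ∑ k, b k ^ 2 * ∑ y, w y * f k y ^ 2 := by
  have h1 : ∀ y, w y * (∑ k, b k * f k y) ^ 2 =
      ∑ j, ∑ k, b j * b k * (w y * (f j y * f k y)) := fun y => by
    rw [sq, Finset.sum_mul_sum, Finset.mul_sum]
    refine Finset.sum_congr rfl fun j _ => ?_
    rw [Finset.mul_sum]
    exact Finset.sum_congr rfl fun k _ => by ring
  simp only [h1]
  rw [Finset.sum_comm]
  refine Finset.sum_congr rfl fun j _ => ?_
  rw [Finset.sum_comm]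
  simp only [← Finset.mul_sum]
  rw [Finset.sum_eq_single j (fun k _ hk => by rw [horth j k hk.symm, mul_zero]) (by simp)]
  simp only [sq]

/-- The deviation operator has norm at most `1 / (1 - lam 1)` on `ℓ²(π)`. -/
theorem devMatrix_norm_sq_le (hP : IsBirthDeath P) (hπ : IsStationary P π) {lam : ℕ → ℝ}
    (h : IsSpectrumEnum P lam) (hN : 1 ≤ N) (g : Fin (N + 1) → ℝ) :
    ∑ x, π x * (∑ y, devMatrix P π x y * g y) ^ 2 ≤
      (1 / (1 - lam 1)) ^ 2 * ∑ x, π x * g x ^ 2 := by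
  obtain ⟨f, hli, -, hf⟩ := h.exists_eigenvectors
  have hD := fun k x => devMatrix_eigenvector hP hπ h (Nat.lt_succ_iff.1 (Fin.is_lt k)) (hf k) x
  have horth : ∀ j k, j ≠ k → ∑ y, π y * (f j y * f k y) = 0 := fun j k hjk =>
    eigenvectors_orthogonal hP hπ (fun e => hjk (Fin.ext
      (h.strictAnti.injOn (Nat.lt_succ_iff.1 j.2) (Nat.lt_succ_iff.1 k.2) e))) (hf j) (hf k)
  let B := basisOfLinearIndependentOfCardEqFinrank hli (by simp)
  have hg : ∀ x, g x = ∑ k, B.repr g k * f k x := fun x => by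
    have := congrFun (B.sum_repr g) x
    simp only [Finset.sum_apply, Pi.smul_apply, smul_eq_mul] at this
    rw [← this]
    simp [B]
  set b := B.repr g
  have hDg : ∀ x, ∑ y, devMatrix P π x y * g y =
      ∑ k : Fin (N + 1), (b k * devEigenvalue lam k) * f k x := fun x => by
    simp only [mul_assoc, ← hD, Finset.mul_sum]
    rw [Finset.sum_comm]
    refine Finset.sum_congr rfl fun y _ => ?_
    rw [hg y, Finset.mul_sum]
    exact Finset.sum_congr rfl fun k _ => by ring
  simp only [hDg]
  have hnorm : ∑ x, π x * g x ^ 2 = ∑ k, b k ^ 2 * ∑ y, π y * f k y ^ 2 := by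
    rw [← sum_sq_expansion horth]
    exact Finset.sum_congr rfl fun x _ => by rw [hg x]
  rw [sum_sq_expansion horth, hnorm, Finset.mul_sum]
  refine Finset.sum_le_sum fun k _ => ?_
  rw [mul_pow, ← mul_assoc]
  refine mul_le_mul_of_nonneg_right ?_
    (Finset.sum_nonneg fun y _ => mul_nonneg (hπ.nonneg y) (sq_nonneg _))
  rw [mul_comm]
  refine mul_le_mul_of_nonneg_right ?_ (sq_nonneg _)
  have hl1 := sub_pos.2 (h.lt_one hP le_rfl hN)
  unfold devEigenvalue
  split_ifs with h0
  · rw [zero_pow two_ne_zero]; exact sq_nonneg _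
  · have hk := Nat.lt_succ_iff.1 k.2
    have hk1 := Nat.one_le_iff_ne_zero.2 h0
    have hlk := sub_pos.2 (h.lt_one hP hk1 hk)
    refine pow_le_pow_left₀ (one_div_pos.2 hlk).le (one_div_le_one_div_of_le hl1 ?_) 2
    linarith [h.strictAnti.antitoneOn (Set.mem_Iic.2 hN) (Set.mem_Iic.2 hk) hk1]

end Spectral

/-! ### Bounding the error terms by the relaxation time. -/

section Bounds

variable {N : ℕ} {P : Matrix (Fin (N + 1)) (Fin (N + 1)) ℝ} {π : Fin (N + 1) → ℝ}

/-- The indicator of the states to the left of `c`. -/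
def leftInd (c x : Fin (N + 1)) : ℝ := if x < c then 1 else 0

/-- The mass of the states to the left of `c`. -/
noncomputable def leftMass (π : Fin (N + 1) → ℝ) (c : Fin (N + 1)) : ℝ := ∑ x, π x * leftInd c x

/-- The deviation operator applied to the indicator of the states to the left of `c`. -/
noncomputable def devLeft (P : Matrix (Fin (N + 1)) (Fin (N + 1)) ℝ) (π : Fin (N + 1) → ℝ)
    (c x : Fin (N + 1)) : ℝ :=
  ∑ y, devMatrix P π x y * leftInd c y

theorem leftInd_le_one (c x : Fin (N + 1)) : leftInd c x ≤ 1 := by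
  unfold leftInd; split_ifs <;> simp

theorem leftInd_sq (c x : Fin (N + 1)) : leftInd c x ^ 2 = leftInd c x := by
  unfold leftInd; split_ifs <;> simp

theorem leftMass_le_one (hπ : IsStationary P π) (c : Fin (N + 1)) : leftMass π c ≤ 1 := by
  rw [← hπ.sum_eq_one]
  exact Finset.sum_le_sum fun x _ => mul_le_of_le_one_right (hπ.nonneg x) (leftInd_le_one c x)

/-- The sets `{x < c}` and `{x ≤ j}` are nested: the product is `leftInd c x` if `c ≤ j` and
`edgeInd x j` otherwise. -/
theorem leftInd_mul_edgeInd (c x : Fin (N + 1)) (j : Fin N) :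
    leftInd c x * edgeInd x j = edgeInd x j - (edgeInd x j - leftInd c x) * edgeInd c j := by
  unfold leftInd edgeInd
  split_ifs with h1 h2 h3 h3 h2 h3 h3 <;> first
    | norm_num; done
    | exact absurd (h1.le.trans h3) h2
    | exact absurd ((not_lt.1 h1).trans h2) h3

theorem sum_leftInd_edge (c : Fin (N + 1)) (j : Fin N) :
    ∑ y, π y * leftInd c y * (edgeInd y j - cdf π j) =
      (cdf π j - edgeInd c j) * (1 - leftMass π c - edgeInd c j) := by
  have h : ∀ y, π y * leftInd c y * (edgeInd y j - cdf π j) =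
      (1 - edgeInd c j) * (π y * edgeInd y j) + (edgeInd c j - cdf π j) * (π y * leftInd c y) :=
    fun y => by linear_combination π y * leftInd_mul_edgeInd c y j
  simp only [h, Finset.sum_add_distrib, ← Finset.mul_sum]
  rw [← cdf, ← leftMass]
  linear_combination - edgeInd_mul_self c j

theorem devLeft_eq (c x : Fin (N + 1)) :
    devLeft P π c x = ∑ j, resistance P π j * (edgeInd x j - cdf π j) *
      ((cdf π j - edgeInd c j) * (1 - leftMass π c - edgeInd c j)) := by
  have := sum_kernel_mul (fun j => resistance P π j * (edgeInd x j - cdf π j))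
    (fun j y => edgeInd y j - cdf π j) (fun y => π y * leftInd c y)
  simp only [sum_leftInd_edge] at this
  rw [← this]
  exact Finset.sum_congr rfl fun y _ => by rw [devMatrix, devKer]; ring

theorem sum_leftInd_mul_devLeft (c : Fin (N + 1)) :
    ∑ x, π x * leftInd c x * devLeft P π c x = ∑ j, resistance P π j *
      ((cdf π j - edgeInd c j) * (1 - leftMass π c - edgeInd c j)) ^ 2 := by
  have := sum_kernel_mul (fun j => resistance P π j *
      ((cdf π j - edgeInd c j) * (1 - leftMass π c - edgeInd c j)))
    (fun j y => edgeInd y j - cdf π j) (fun y => π y * leftInd c y)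
  simp only [sum_leftInd_edge] at this
  rw [Finset.sum_congr rfl fun j _ => show resistance P π j *
      ((cdf π j - edgeInd c j) * (1 - leftMass π c - edgeInd c j)) ^ 2 = resistance P π j *
      ((cdf π j - edgeInd c j) * (1 - leftMass π c - edgeInd c j)) *
      ((cdf π j - edgeInd c j) * (1 - leftMass π c - edgeInd c j)) by ring, ← this]
  refine Finset.sum_congr rfl fun x _ => ?_
  rw [devLeft_eq, mul_comm]
  congr 1
  exact Finset.sum_congr rfl fun j _ => by ring

/-- The centred indicator equals `1 - leftMass π c` on the whole left side, so left of `c` the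
Poisson equation, normalised to vanish at `c`, is that multiple of the hitting-time equation. With
its counterpart on the right, this transfers the norm bound for `D` to the mean hitting times. -/
theorem devLeft_sub_of_le (hπ : IsStationary P π) {c x : Fin (N + 1)} (h : x ≤ c) :
    devLeft P π c x - devLeft P π c c =
      (1 - leftMass π c) * green (resistance P π) π c 1 x := by
  rw [green_one hπ.sum_eq_one, devLeft_eq, devLeft_eq, ← Finset.sum_sub_distrib, Finset.mul_sum]
  refine Finset.sum_congr rfl fun j _ => ?_
  linear_combination - resistance P π j * (cdf π j - edgeInd c j) *
    (edgeInd_mul_of_le h j - edgeInd_mul_self c j)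

theorem devLeft_sub_of_ge (hπ : IsStationary P π) {c x : Fin (N + 1)} (h : c ≤ x) :
    devLeft P π c x - devLeft P π c c =
      - (leftMass π c * green (resistance P π) π c 1 x) := by
  rw [green_one hπ.sum_eq_one, devLeft_eq, devLeft_eq, ← Finset.sum_sub_distrib, Finset.mul_sum,
    ← Finset.sum_neg_distrib]
  refine Finset.sum_congr rfl fun j _ => ?_
  linear_combination - resistance P π j * (cdf π j - edgeInd c j) *
    (edgeInd_mul_of_le h j - edgeInd_mul_self c j)

variable {lam : ℕ → ℝ} {c : Fin (N + 1)} {ε : ℝ}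

theorem devLeft_norm_sq_le (hP : IsBirthDeath P) (hπ : IsStationary P π)
    (h : IsSpectrumEnum P lam) (hN : 1 ≤ N) (c : Fin (N + 1)) :
    ∑ x, π x * devLeft P π c x ^ 2 ≤ (1 / (1 - lam 1)) ^ 2 := by
  refine (devMatrix_norm_sq_le hP hπ h hN (leftInd c)).trans
    (mul_le_of_le_one_right (sq_nonneg _) ?_)
  simp only [leftInd_sq]
  exact leftMass_le_one hπ c

/-- The quadratic form of `D` at the left indicator weights each term of `meanGreen` by the square
of the mass on one side, at least `ε ^ 2`; the norm bound caps the form by `τ`. -/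
theorem meanGreen_le (hP : IsBirthDeath P) (hπ : IsStationary P π) (h : IsSpectrumEnum P lam)
    (hN : 1 ≤ N) (hε : 0 < ε) (hl : ε ≤ leftMass π c) (hr : ε ≤ 1 - leftMass π c) :
    meanGreen (resistance P π) π c ≤ (1 / (1 - lam 1)) / ε ^ 2 := by
  have hτ : 0 < 1 / (1 - lam 1) := one_div_pos.2 (sub_pos.2 (h.lt_one hP le_rfl hN))
  set τ := 1 / (1 - lam 1) with hτ'
  have h1 : meanGreen (resistance P π) π c * ε ^ 2 ≤
      ∑ x, π x * leftInd c x * devLeft P π c x := by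
    rw [sum_leftInd_mul_devLeft, meanGreen, Finset.sum_mul]
    refine Finset.sum_le_sum fun j _ => ?_
    rw [mul_assoc, mul_pow]
    refine mul_le_mul_of_nonneg_left (mul_le_mul_of_nonneg_left ?_ (sq_nonneg _))
      (resistance_pos hP hπ j).le
    rcases edgeInd_eq_zero_or_one c j with e | e <;> rw [e] <;> nlinarith
  -- Cauchy–Schwarz in the form `2 a b ≤ τ a² + b² / τ`, with `τ` balancing the two terms.
  have h2 : 2 * ∑ x, π x * leftInd c x * devLeft P π c x ≤
      τ * leftMass π c + (∑ x, π x * devLeft P π c x ^ 2) / τ := by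
    rw [leftMass, Finset.mul_sum, Finset.mul_sum, Finset.sum_div, ← Finset.sum_add_distrib]
    refine Finset.sum_le_sum fun x _ => ?_
    have h3 : 0 ≤ π x * (τ * leftInd c x - devLeft P π c x) ^ 2 / τ :=
      div_nonneg (mul_nonneg (hπ.nonneg x) (sq_nonneg _)) hτ.le
    have h4 : π x * (τ * leftInd c x - devLeft P π c x) ^ 2 / τ = τ * (π x * leftInd c x) +
        π x * devLeft P π c x ^ 2 / τ - 2 * (π x * leftInd c x * devLeft P π c x) := by
      field_simp
      linear_combination π x * τ ^ 2 * leftInd_sq c x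
    linarith
  have h3 := devLeft_norm_sq_le hP hπ h hN c
  rw [← hτ'] at h3
  have h4 : (∑ x, π x * devLeft P π c x ^ 2) / τ ≤ τ := by
    rw [div_le_iff₀ hτ]; nlinarith
  have h5 := leftMass_le_one hπ c
  rw [le_div_iff₀ (pow_pos hε 2)]
  nlinarith

theorem green_one_nonneg (hP : IsBirthDeath P) (hπ : IsStationary P π) (c x : Fin (N + 1)) :
    0 ≤ green (resistance P π) π c 1 x :=
  green_nonneg (fun j => (resistance_pos hP hπ j).le) hπ.nonneg c (fun _ => zero_le_one) x

theorem leftMass_eq_sub (hπ : IsStationary P π) (c : Fin (N + 1)) :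
    1 - leftMass π c = ∑ x, π x * (1 - leftInd c x) := by
  simp only [mul_sub, mul_one, Finset.sum_sub_distrib, hπ.sum_eq_one, leftMass]

/-- `devLeft` is at least its value at `c` on the left and at most that value on the right.
According to the sign of this value, one of the two sides, of mass at least `ε`, has `|devLeft|` at
least as large as at `c`. -/
theorem devLeft_sq_le (hP : IsBirthDeath P) (hπ : IsStationary P π)
    (hl : ε ≤ leftMass π c) (hr : ε ≤ 1 - leftMass π c) (hε : 0 < ε) :
    ε * devLeft P π c c ^ 2 ≤ ∑ x, π x * devLeft P π c x ^ 2 := by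
  have hl1 : 0 ≤ leftMass π c := hε.le.trans hl
  have hr1 : 0 ≤ 1 - leftMass π c := hε.le.trans hr
  rcases le_total 0 (devLeft P π c c) with h0 | h0
  · refine (mul_le_mul_of_nonneg_right hl (sq_nonneg _)).trans ?_
    rw [leftMass, Finset.sum_mul]
    refine Finset.sum_le_sum fun x _ => ?_
    rw [mul_assoc]
    refine mul_le_mul_of_nonneg_left ?_ (hπ.nonneg x)
    unfold leftInd
    split_ifs with hx
    · rw [one_mul]
      refine pow_le_pow_left₀ h0 ?_ 2
      rw [← sub_nonneg, devLeft_sub_of_le hπ hx.le]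
      exact mul_nonneg hr1 (green_one_nonneg hP hπ c x)
    · rw [zero_mul]; exact sq_nonneg _
  · refine (mul_le_mul_of_nonneg_right hr (sq_nonneg _)).trans ?_
    rw [leftMass_eq_sub hπ, Finset.sum_mul]
    refine Finset.sum_le_sum fun x _ => ?_
    rw [mul_assoc]
    refine mul_le_mul_of_nonneg_left ?_ (hπ.nonneg x)
    unfold leftInd
    split_ifs with hx
    · rw [sub_self, zero_mul]; exact sq_nonneg _
    · rw [sub_zero, one_mul]
      have h1 := devLeft_sub_of_ge hπ (not_lt.1 hx)
      have h2 := mul_nonneg hl1 (green_one_nonneg hP hπ c x)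
      nlinarith

/-- On both sides `ε * u ≤ |devLeft x - devLeft c|`. The factor `2` is from `(a - b)² ≤ 2 a² + 2
b²`, and `1 / ε` from the value at `c`. -/
theorem sum_green_sq_le (hP : IsBirthDeath P) (hπ : IsStationary P π) (h : IsSpectrumEnum P lam)
    (hN : 1 ≤ N) (hε : 0 < ε) (hl : ε ≤ leftMass π c) (hr : ε ≤ 1 - leftMass π c) :
    ∑ x, π x * green (resistance P π) π c 1 x ^ 2 ≤
      (2 * (1 + 1 / ε) / ε ^ 2) * (1 / (1 - lam 1)) ^ 2 := by
  have h1 := devLeft_norm_sq_le hP hπ h hN c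
  have h2 := devLeft_sq_le hP hπ hl hr hε
  have h3 : devLeft P π c c ^ 2 ≤ 1 / ε * (1 / (1 - lam 1)) ^ 2 := by
    rw [one_div_mul_eq_div, le_div_iff₀ hε]; linarith
  have h4 : ∀ x, π x * green (resistance P π) π c 1 x ^ 2 * ε ^ 2 ≤
      2 * (π x * devLeft P π c x ^ 2) + π x * (2 * devLeft P π c c ^ 2) := fun x => by
    have hu := green_one_nonneg hP hπ c x
    have h5 : ε ^ 2 * green (resistance P π) π c 1 x ^ 2 ≤
        (devLeft P π c x - devLeft P π c c) ^ 2 := by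
      rw [← mul_pow]
      rcases le_total x c with hx | hx
      · rw [devLeft_sub_of_le hπ hx]
        exact pow_le_pow_left₀ (mul_nonneg hε.le hu) (mul_le_mul_of_nonneg_right hr hu) 2
      · rw [devLeft_sub_of_ge hπ hx, neg_sq]
        exact pow_le_pow_left₀ (mul_nonneg hε.le hu) (mul_le_mul_of_nonneg_right hl hu) 2
    nlinarith [mul_le_mul_of_nonneg_left h5 (hπ.nonneg x),
      mul_nonneg (hπ.nonneg x) (sq_nonneg (devLeft P π c x + devLeft P π c c))]
  have h5 := Finset.sum_le_sum fun x (_ : x ∈ Finset.univ) => h4 x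
  rw [← Finset.sum_mul, Finset.sum_add_distrib, ← Finset.mul_sum, ← Finset.sum_mul,
    hπ.sum_eq_one] at h5
  rw [div_mul_eq_mul_div, le_div_iff₀ (pow_pos hε 2)]
  nlinarith

theorem one_le_green (hP : IsBirthDeath P) (hπ : IsStationary P π) {x : Fin (N + 1)}
    (hx : x ≠ c) : 1 ≤ green (resistance P π) π c 1 x := by
  have h1 := lap_green hP hπ hx 1
  rw [lap, Pi.one_apply] at h1
  have : 0 ≤ ∑ y, P x y * green (resistance P π) π c 1 y :=
    Finset.sum_nonneg fun y _ => mul_nonneg (hP.nonneg x y) (green_one_nonneg hP hπ c y)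
  linarith

/-- Off `c` a hitting time is at least one and at `c` it is zero, so `u ≤ u²`. Together with Jensen
this gives the correction in `varSum_eq` a sign. -/
theorem meanGreen_le_sum_sq (hP : IsBirthDeath P) (hπ : IsStationary P π) (c : Fin (N + 1)) :
    meanGreen (resistance P π) π c ≤ ∑ x, π x * green (resistance P π) π c 1 x ^ 2 := by
  rw [← sum_green_one hπ.sum_eq_one]
  refine Finset.sum_le_sum fun x _ => mul_le_mul_of_nonneg_left ?_ (hπ.nonneg x)
  by_cases hx : x = c
  · rw [hx, green_self]; norm_num
  · nlinarith [one_le_green hP hπ hx]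

theorem meanGreen_sq_le (hπ : IsStationary P π) (c : Fin (N + 1)) :
    meanGreen (resistance P π) π c ^ 2 ≤ ∑ x, π x * green (resistance P π) π c 1 x ^ 2 := by
  set κ := meanGreen (resistance P π) π c with hκ
  have h0 : 0 ≤ ∑ x, π x * (green (resistance P π) π c 1 x - κ) ^ 2 :=
    Finset.sum_nonneg fun x _ => mul_nonneg (hπ.nonneg x) (sq_nonneg _)
  have h1 : ∀ x, π x * (green (resistance P π) π c 1 x - κ) ^ 2 =
      π x * green (resistance P π) π c 1 x ^ 2 - 2 * κ * (π x * green (resistance P π) π c 1 x)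
        + π x * κ ^ 2 := fun x => by ring
  simp only [h1, Finset.sum_add_distrib, Finset.sum_sub_distrib, ← Finset.mul_sum,
    ← Finset.sum_mul, hπ.sum_eq_one, sum_green_one hπ.sum_eq_one, ← hκ] at h0
  nlinarith

/-- The variance of the hitting time of `c` from `0`. -/
noncomputable def leftVar (P : Matrix (Fin (N + 1)) (Fin (N + 1)) ℝ) (π : Fin (N + 1) → ℝ)
    (c : Fin (N + 1)) : ℝ :=
  leftTraceSq (resistance P π) π c - leftTrace (resistance P π) π c

theorem leftVar_monotone (hP : IsBirthDeath P) (hπ : IsStationary P π) :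
    Monotone (leftVar P π) :=
  leftVar_mono (fun j => (resistance_pos hP hπ j).le) hπ.nonneg (one_le_resistance_mul_cdf hP hπ)

theorem leftVar_nonneg (hP : IsBirthDeath P) (hπ : IsStationary P π) (c : Fin (N + 1)) :
    0 ≤ leftVar P π c := by
  refine le_trans (le_of_eq ?_) (leftVar_monotone hP hπ (Fin.zero_le c))
  simp [leftVar, leftTraceSq, leftTrace, leftKer_eq_zero (Fin.zero_le _)]

theorem invGapSum_eq_leftTrace (hP : IsBirthDeath P) (hs : IsSymmetricChain P)
    (hπ : IsStationary P π) (h : IsSpectrumEnum P lam) (c : Fin (N + 1)) :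
    invGapSum lam N = leftTrace (resistance P π) π c + leftTrace (resistance P π) π c.rev -
      meanGreen (resistance P π) π c := by
  rw [invGapSum_eq hP hπ h, sum_devKer (resistance_rev hP hs hπ) (hπ.rev_eq hP hs) hπ.sum_eq_one c]

theorem varSum_eq (hP : IsBirthDeath P) (hs : IsSymmetricChain P)
    (hπ : IsStationary P π) (h : IsSpectrumEnum P lam) (c : Fin (N + 1)) :
    varSum lam N = leftVar P π c + leftVar P π c.rev -
      (2 * ∑ x, π x * green (resistance P π) π c 1 x ^ 2 - meanGreen (resistance P π) π c ^ 2
        - meanGreen (resistance P π) π c) := by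
  have h1 := varSum_add_invGapSum hP hπ h
  rw [sum_devKer_sq (resistance_rev hP hs hπ) (hπ.rev_eq hP hs) hπ.sum_eq_one c,
    invGapSum_eq_leftTrace hP hs hπ h c] at h1
  unfold leftVar
  linarith

/-- The correction `2 π(u²) - κ² - κ` is nonnegative, and `leftVar` at `c.rev` is at most `leftVar`
at `c`. -/
theorem varSum_le (hP : IsBirthDeath P) (hs : IsSymmetricChain P)
    (hπ : IsStationary P π) (h : IsSpectrumEnum P lam) (hc : c.rev ≤ c) :
    varSum lam N ≤ 2 * leftVar P π c := by
  have h1 := leftVar_monotone hP hπ hc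
  rw [varSum_eq hP hs hπ h c]
  linarith [meanGreen_sq_le hπ c, meanGreen_le_sum_sq hP hπ c]

theorem leftVar_le (hP : IsBirthDeath P) (hs : IsSymmetricChain P)
    (hπ : IsStationary P π) (h : IsSpectrumEnum P lam) (c : Fin (N + 1)) :
    leftVar P π c ≤ varSum lam N + 2 * ∑ x, π x * green (resistance P π) π c 1 x ^ 2 := by
  have h1 := leftVar_nonneg hP hπ c.rev
  rw [varSum_eq hP hs hπ h c]
  linarith [sq_nonneg (meanGreen (resistance P π) π c),
    meanGreen_nonneg (π := π) (fun j => (resistance_pos hP hπ j).le) c]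

theorem varSum_le_mul_invGapSum (hP : IsBirthDeath P) (h : IsSpectrumEnum P lam) :
    varSum lam N ≤ 1 / (1 - lam 1) * invGapSum lam N := by
  rw [varSum, invGapSum, Finset.mul_sum]
  refine Finset.sum_le_sum fun k hk => ?_
  obtain ⟨hk1, hk2⟩ := Finset.mem_Icc.1 hk
  have hN := hk1.trans hk2
  have h1 := sub_pos.2 (h.lt_one hP le_rfl hN)
  have hk0 := sub_pos.2 (h.lt_one hP hk1 hk2)
  have h2 := h.strictAnti.antitoneOn (Set.mem_Iic.2 hN) (Set.mem_Iic.2 hk2) hk1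
  calc lam k / (1 - lam k) ^ 2 ≤ 1 / (1 - lam k) ^ 2 :=
        div_le_div_of_nonneg_right (by linarith) (sq_nonneg _)
    _ = 1 / (1 - lam k) * (1 / (1 - lam k)) := by rw [sq, one_div_mul_one_div]
    _ ≤ 1 / (1 - lam 1) * (1 / (1 - lam k)) :=
        mul_le_mul_of_nonneg_right (one_div_le_one_div_of_le h1 (by linarith))
          (one_div_pos.2 hk0).le

theorem le_cdf_of_rev_le (hP : IsBirthDeath P) (hs : IsSymmetricChain P) (hπ : IsStationary P π)
    (hr : ε ≤ 1 - leftMass π c) (j : Fin N) (hj : c.rev ≤ j.castSucc) : ε ≤ cdf π j := by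
  refine hr.trans ?_
  rw [leftMass_eq_sub hπ, cdf, ← Equiv.sum_comp Fin.revPerm]
  refine Finset.sum_le_sum fun x _ => ?_
  rw [Fin.revPerm_apply, hπ.rev_eq hP hs]
  refine mul_le_mul_of_nonneg_left ?_ (hπ.nonneg x)
  unfold leftInd edgeInd
  split_ifs with h1 h2 h2
  · simp
  · simp
  · simp
  · refine absurd ?_ h2
    have : x ≤ c.rev := by rw [← Fin.rev_le_rev, Fin.rev_rev]; exact not_lt.1 h1
    exact this.trans hj

/-- The difference is `κ` plus the increment of `leftTrace` from `c.rev` to `c`. Both are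
nonnegative, and the increment is at most `κ / ε`. -/
theorem abs_two_mul_leftTrace_sub_le (hP : IsBirthDeath P) (hs : IsSymmetricChain P)
    (hπ : IsStationary P π) (h : IsSpectrumEnum P lam) (hN : 1 ≤ N) (hε : 0 < ε)
    (hl : ε ≤ leftMass π c) (hr : ε ≤ 1 - leftMass π c) (hc : c.rev ≤ c) :
    |2 * leftTrace (resistance P π) π c - invGapSum lam N| ≤
      ((1 + 1 / ε) / ε ^ 2) * (1 / (1 - lam 1)) := by
  have hr0 := fun j => (resistance_pos hP hπ j).le
  have h1 := leftTrace_mono (π := π) hr0 (cdf_nonneg hπ) hc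
  have h2 := leftTrace_sub_le hr0 hε hc (le_cdf_of_rev_le hP hs hπ hr)
  have h3 := meanGreen_nonneg (π := π) hr0 c
  have h4 := meanGreen_le hP hπ h hN hε hl hr
  rw [invGapSum_eq_leftTrace hP hs hπ h c, abs_of_nonneg (by linarith)]
  calc _ ≤ (1 + 1 / ε) * meanGreen (resistance P π) π c := by
        rw [add_mul, one_mul, one_div_mul_eq_div]; linarith
    _ ≤ (1 + 1 / ε) * (1 / (1 - lam 1) / ε ^ 2) :=
        mul_le_mul_of_nonneg_left h4 (by positivity)
    _ = _ := by ring

end Bounds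

/-! ### Survival probabilities of the killed chain. -/

section Killed

variable {N : ℕ} {P : Matrix (Fin (N + 1)) (Fin (N + 1)) ℝ} {π : Fin (N + 1) → ℝ}

/-- The transition operator of the chain killed at `c`. -/
noncomputable def killedOp (P : Matrix (Fin (N + 1)) (Fin (N + 1)) ℝ) (c : Fin (N + 1)) :
    (Fin (N + 1) → ℝ) →ₗ[ℝ] (Fin (N + 1) → ℝ) where
  toFun g x := if x = c then 0 else ∑ y, P x y * g y
  map_add' f g := by
    ext x
    by_cases h : x = c <;> simp [h, mul_add, Finset.sum_add_distrib]
  map_smul' a f := by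
    ext x
    by_cases h : x = c <;> simp [h, Finset.mul_sum, mul_left_comm]

theorem killedOp_apply (c : Fin (N + 1)) (g : Fin (N + 1) → ℝ) (x : Fin (N + 1)) :
    killedOp P c g x = if x = c then 0 else ∑ y, P x y * g y := rfl

/-- The indicator of the complement of `c`. -/
def offInd (c x : Fin (N + 1)) : ℝ := if x = c then 0 else 1

/-- `surv P c n x` is the probability that the chain started at `x` has not visited `c` by
time `n`. -/
noncomputable def surv (P : Matrix (Fin (N + 1)) (Fin (N + 1)) ℝ) (c : Fin (N + 1)) (n : ℕ) :
    Fin (N + 1) → ℝ :=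
  (killedOp P c ^ n) (offInd c)

theorem surv_zero (c : Fin (N + 1)) : surv P c 0 = offInd c := rfl

theorem surv_succ (c : Fin (N + 1)) (n : ℕ) : surv P c (n + 1) = killedOp P c (surv P c n) := by
  rw [surv, pow_succ']; rfl

theorem surv_add (c : Fin (N + 1)) (n k : ℕ) :
    surv P c (n + k) = (killedOp P c ^ n) (surv P c k) := by
  rw [surv, pow_add]; rfl

theorem surv_self (c : Fin (N + 1)) (n : ℕ) : surv P c n c = 0 := by
  cases n with
  | zero => simp [surv_zero, offInd]
  | succ n => simp [surv_succ, killedOp_apply]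

theorem killedOp_mono (hP : IsBirthDeath P) (c : Fin (N + 1)) : Monotone (killedOp P c) := by
  intro f g h x
  rw [killedOp_apply, killedOp_apply]
  split_ifs
  · exact le_rfl
  · exact Finset.sum_le_sum fun y _ => mul_le_mul_of_nonneg_left (h y) (hP.nonneg x y)

theorem killedOp_pow_mono (hP : IsBirthDeath P) (c : Fin (N + 1)) (n : ℕ) :
    Monotone (killedOp P c ^ n : Module.End ℝ (Fin (N + 1) → ℝ)) := by
  rw [Module.End.coe_pow]
  exact (killedOp_mono hP c).iterate n

theorem killedOp_pow_nonneg (hP : IsBirthDeath P) (c : Fin (N + 1)) (n : ℕ)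
    {g : Fin (N + 1) → ℝ} (hg : 0 ≤ g) : 0 ≤ (killedOp P c ^ n) g := by
  have := killedOp_pow_mono hP c n hg
  rwa [map_zero] at this

theorem offInd_nonneg (c : Fin (N + 1)) : 0 ≤ offInd c := fun x => by
  unfold offInd; split_ifs <;> simp

theorem surv_nonneg (hP : IsBirthDeath P) (c : Fin (N + 1)) (n : ℕ) : 0 ≤ surv P c n :=
  killedOp_pow_nonneg hP c n (offInd_nonneg c)

theorem surv_one_le (hP : IsBirthDeath P) (c : Fin (N + 1)) : surv P c 1 ≤ surv P c 0 := by
  intro x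
  rw [surv_succ, surv_zero, killedOp_apply, offInd]
  split_ifs
  · exact le_rfl
  · rw [← hP.row_sum x]
    refine Finset.sum_le_sum fun y _ => mul_le_of_le_one_right (hP.nonneg x y) ?_
    unfold offInd; split_ifs <;> simp

theorem surv_antitone (hP : IsBirthDeath P) (c : Fin (N + 1)) : Antitone (surv P c) := by
  refine antitone_nat_of_succ_le fun n => ?_
  rw [surv_add, show surv P c n = surv P c (n + 0) from rfl, surv_add]
  exact killedOp_pow_mono hP c n (surv_one_le hP c)

theorem surv_le_one (hP : IsBirthDeath P) (c : Fin (N + 1)) (n : ℕ) (x : Fin (N + 1)) :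
    surv P c n x ≤ 1 := by
  refine (surv_antitone hP c (Nat.zero_le n) x).trans ?_
  rw [surv_zero, offInd]; split_ifs <;> simp

/-- `green g = g 1_{≠ c} + killedOp (green g)`. -/
theorem green_eq_add_killedOp (hP : IsBirthDeath P) (hπ : IsStationary P π) (c : Fin (N + 1))
    (g : Fin (N + 1) → ℝ) (hg : g c = 0) :
    green (resistance P π) π c g = g + killedOp P c (green (resistance P π) π c g) := by
  ext x
  rw [Pi.add_apply, killedOp_apply]
  split_ifs with h
  · rw [h, green_self, hg, add_zero]
  · have := lap_green hP hπ h g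
    rw [lap] at this
    linarith

theorem green_one_eq (c : Fin (N + 1)) (r : Fin N → ℝ) :
    green r π c 1 = green r π c (offInd c) := by
  ext x
  refine Finset.sum_congr rfl fun y _ => ?_
  by_cases h : y = c
  · rw [h, hitKer_symm]; simp [hitKer]
  · simp [offInd, h]

/-- Neumann series with exact remainder. For `g ≥ 0` the remainder is nonnegative, which gives
summability before any convergence is known. -/
theorem sum_killedOp_pow (hP : IsBirthDeath P) (hπ : IsStationary P π) (c : Fin (N + 1))
    (g : Fin (N + 1) → ℝ) (hg : g c = 0) (n : ℕ) :
    ∑ k ∈ Finset.range n, (killedOp P c ^ k) g = green (resistance P π) π c g -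
      (killedOp P c ^ n) (green (resistance P π) π c g) := by
  induction n with
  | zero => simp
  | succ n ih =>
    have := congrArg (killedOp P c ^ n) (green_eq_add_killedOp hP hπ c g hg)
    rw [map_add] at this
    rw [Finset.sum_range_succ, ih, pow_succ, Module.End.mul_apply]
    linear_combination -this

theorem summable_surv (hP : IsBirthDeath P) (hπ : IsStationary P π) (c x : Fin (N + 1)) :
    Summable fun n => surv P c n x := by
  refine summable_of_sum_range_le (c := green (resistance P π) π c 1 x)
    (fun n => surv_nonneg hP c n x) fun n => ?_
  have h1 := congrFun (sum_killedOp_pow hP hπ c (offInd c) (by simp [offInd]) n) x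
  rw [← green_one_eq, Finset.sum_apply, Pi.sub_apply] at h1
  have h2 := killedOp_pow_nonneg hP c n (g := green (resistance P π) π c 1)
    (fun y => green_one_nonneg hP hπ c y) x
  rw [Pi.zero_apply] at h2
  unfold surv
  linarith

theorem tendsto_surv (hP : IsBirthDeath P) (hπ : IsStationary P π) (c x : Fin (N + 1)) :
    Tendsto (fun n => surv P c n x) atTop (𝓝 0) :=
  (summable_surv hP hπ c x).tendsto_atTop_zero

theorem tendsto_killedOp_pow (hP : IsBirthDeath P) (hπ : IsStationary P π) (c x : Fin (N + 1))
    {g : Fin (N + 1) → ℝ} (hg : 0 ≤ g) (hgc : g c = 0) :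
    Tendsto (fun n => (killedOp P c ^ n) g x) atTop (𝓝 0) := by
  have h1 : g ≤ (∑ y, g y) • offInd c := fun y => by
    by_cases h : y = c
    · simp [offInd, h, hgc]
    · simpa [offInd, h] using Finset.single_le_sum (fun y _ => hg y) (Finset.mem_univ y)
  refine squeeze_zero (fun n => killedOp_pow_nonneg hP c n hg x)
    (g := fun n => (∑ y, g y) * surv P c n x) (fun n => ?_) ?_
  · have := killedOp_pow_mono hP c n h1 x
    rwa [map_smul] at this
  · simpa using (tendsto_surv hP hπ c x).const_mul (∑ y, g y)

theorem hasSum_killedOp_pow (hP : IsBirthDeath P) (hπ : IsStationary P π) (c x : Fin (N + 1))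
    {g : Fin (N + 1) → ℝ} (hg : 0 ≤ g) (hgc : g c = 0) :
    HasSum (fun n => (killedOp P c ^ n) g x) (green (resistance P π) π c g x) := by
  rw [hasSum_iff_tendsto_nat_of_nonneg fun n => killedOp_pow_nonneg hP c n hg x]
  have h := tendsto_killedOp_pow hP hπ c x (g := green (resistance P π) π c g)
    (fun y => green_nonneg (fun j => (resistance_pos hP hπ j).le) hπ.nonneg c hg y)
    (green_self c g)
  have h2 := (tendsto_const_nhds (x := green (resistance P π) π c g x)).sub h
  rw [sub_zero] at h2
  refine h2.congr fun n => ?_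
  have := congrFun (sum_killedOp_pow hP hπ c g hgc n) x
  rw [Finset.sum_apply, Pi.sub_apply] at this
  exact this.symm

theorem hasSum_surv (hP : IsBirthDeath P) (hπ : IsStationary P π) (c x : Fin (N + 1)) :
    HasSum (fun n => surv P c n x) (green (resistance P π) π c 1 x) := by
  rw [green_one_eq]
  exact hasSum_killedOp_pow hP hπ c x (offInd_nonneg c) (by simp [offInd])

theorem hasSum_surv_add (hP : IsBirthDeath P) (hπ : IsStationary P π) (c x : Fin (N + 1)) (k : ℕ) :
    HasSum (fun n => surv P c (n + k) x)
      ((killedOp P c ^ k) (green (resistance P π) π c 1) x) := by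
  have h := hasSum_surv hP hπ c x
  have h1 := congrFun (sum_killedOp_pow hP hπ c (offInd c) (by simp [offInd]) k) x
  rw [← green_one_eq, Finset.sum_apply, Pi.sub_apply] at h1
  rw [hasSum_nat_add_iff (f := fun n => surv P c n x) k]
  convert! h using 1
  unfold surv
  linarith

/-- Summing the tails along antidiagonals counts `p n` exactly `n + 1` times. -/
theorem hasSum_succ_mul_of_tails {p q : ℕ → ℝ} {w : ℝ} (hp : ∀ n, 0 ≤ p n)
    (hq : ∀ k, HasSum (fun n => p (n + k)) (q k)) (hw : HasSum q w) :
    HasSum (fun n : ℕ => ((n : ℝ) + 1) * p n) w := by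
  have hs : Summable fun z : ℕ × ℕ => p (z.2 + z.1) := by
    rw [summable_prod_of_nonneg fun z => hp _]
    refine ⟨fun k => (hq k).summable, ?_⟩
    simp only [(hq _).tsum_eq]
    exact hw.summable
  have h1 : HasSum (fun z : ℕ × ℕ => p (z.2 + z.1)) w := by
    rw [hw.unique (hs.hasSum.prod_fiberwise hq)]
    exact hs.hasSum
  have h2 := ((Finset.HasAntidiagonal.sigmaAntidiagonalEquivProd (A := ℕ)).hasSum_iff.2 h1).sigma
    (fun n => hasSum_fintype _)
  convert! h2 using 2 with n
  have h3 : ∀ z : Finset.HasAntidiagonal.antidiagonal n,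
      p ((z : ℕ × ℕ).2 + (z : ℕ × ℕ).1) = p n := fun z => by
    rw [add_comm, Finset.HasAntidiagonal.mem_antidiagonal.1 z.2]
  simp only [Function.comp_def, Finset.HasAntidiagonal.sigmaAntidiagonalEquivProd_apply, h3]
  simp

theorem hasSum_succ_mul_surv (hP : IsBirthDeath P) (hπ : IsStationary P π) (c x : Fin (N + 1)) :
    HasSum (fun n : ℕ => ((n : ℝ) + 1) * surv P c n x)
      (green (resistance P π) π c (green (resistance P π) π c 1) x) :=
  hasSum_succ_mul_of_tails (fun n => surv_nonneg hP c n x) (hasSum_surv_add hP hπ c x)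
    (hasSum_killedOp_pow hP hπ c x (fun y => green_one_nonneg hP hπ c y) (green_self c 1))

/-- Markov's inequality for the hitting time, from the monotonicity of survival. -/
theorem mul_surv_le_green (hP : IsBirthDeath P) (hπ : IsStationary P π) (c x : Fin (N + 1))
    (n : ℕ) : ((n : ℝ) + 1) * surv P c n x ≤ green (resistance P π) π c 1 x := by
  have h := sum_le_hasSum (Finset.range (n + 1)) (fun k _ => surv_nonneg hP c k x)
    (hasSum_surv hP hπ c x)
  refine le_trans ?_ h
  have := Finset.card_nsmul_le_sum (Finset.range (n + 1)) (fun k => surv P c k x) (surv P c n x)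
    fun k hk => surv_antitone hP c (Nat.lt_succ_iff.1 (Finset.mem_range.1 hk)) x
  simpa using this

theorem killedOp_pow_le (hP : IsBirthDeath P) (c : Fin (N + 1)) {g : Fin (N + 1) → ℝ}
    (hg : 0 ≤ g) (n : ℕ) (x : Fin (N + 1)) : (killedOp P c ^ n) g x ≤ ∑ y, (P ^ n) x y * g y := by
  induction n generalizing x with
  | zero => simp [Matrix.one_apply]
  | succ n ih =>
    have h0 : ∀ y, 0 ≤ ∑ z, (P ^ n) y z * g z := fun y =>
      (killedOp_pow_nonneg hP c n hg y).trans (ih y)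
    have h1 : ∑ z, (P ^ (n + 1)) x z * g z = ∑ y, P x y * ∑ z, (P ^ n) y z * g z := by
      simp only [pow_succ', Matrix.mul_apply, Finset.sum_mul, Finset.mul_sum]
      rw [Finset.sum_comm]
      simp only [mul_assoc]
    rw [h1, pow_succ', Module.End.mul_apply, killedOp_apply]
    split_ifs
    · exact Finset.sum_nonneg fun y _ => mul_nonneg (hP.nonneg x y) (h0 y)
    · exact Finset.sum_le_sum fun y _ => mul_le_mul_of_nonneg_left (ih y) (hP.nonneg x y)

theorem pow_row (hP : IsBirthDeath P) (n : ℕ) (x : Fin (N + 1)) :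
    (∀ y, 0 ≤ (P ^ n) x y) ∧ ∑ y, (P ^ n) x y = 1 := by
  induction n generalizing x with
  | zero => exact ⟨fun y => by rw [pow_zero, Matrix.one_apply]; split_ifs <;> simp, by
      simp [Matrix.one_apply]⟩
  | succ n ih =>
    simp only [pow_succ', Matrix.mul_apply]
    refine ⟨fun y => Finset.sum_nonneg fun z _ => mul_nonneg (hP.nonneg x z) ((ih z).1 y), ?_⟩
    rw [Finset.sum_comm]
    simp only [← Finset.mul_sum, (ih _).2, mul_one, hP.row_sum]

theorem tvDist_nonneg (ν π : Fin (N + 1) → ℝ) : 0 ≤ tvDist ν π :=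
  mul_nonneg (by norm_num) (Finset.sum_nonneg fun x _ => abs_nonneg _)

theorem tvDist_le_one {ν π : Fin (N + 1) → ℝ} (hν : ∀ x, 0 ≤ ν x) (hν1 : ∑ x, ν x = 1)
    (hπ : ∀ x, 0 ≤ π x) (hπ1 : ∑ x, π x = 1) : tvDist ν π ≤ 1 := by
  have : ∑ x, |ν x - π x| ≤ ∑ x, (ν x + π x) :=
    Finset.sum_le_sum fun x _ => abs_le.2 ⟨by linarith [hν x], by linarith [hπ x]⟩
  rw [Finset.sum_add_distrib, hν1, hπ1] at this
  unfold tvDist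
  linarith

theorem sub_le_tvDist {ν π : Fin (N + 1) → ℝ} (hν1 : ∑ x, ν x = 1) (hπ1 : ∑ x, π x = 1)
    {a : Fin (N + 1) → ℝ} (h0 : ∀ x, 0 ≤ a x) (h1 : ∀ x, a x ≤ 1) :
    ∑ x, ν x * a x - ∑ x, π x * a x ≤ tvDist ν π := by
  -- Centring the test function at `1 / 2` is free, as both masses are one, and produces the factor
  -- `1 / 2` of `tvDist`.
  have h2 : ∑ x, ν x * a x - ∑ x, π x * a x = ∑ x, (ν x - π x) * (a x - 1 / 2) := by
    simp only [sub_mul, mul_sub, Finset.sum_sub_distrib, ← Finset.sum_mul, hν1, hπ1]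
    ring
  rw [h2, tvDist, Finset.mul_sum]
  refine Finset.sum_le_sum fun x _ => (le_abs_self _).trans ?_
  rw [abs_mul, mul_comm]
  refine mul_le_mul_of_nonneg_right (abs_le.2 ⟨?_, ?_⟩) (abs_nonneg _) <;>
    linarith [h0 x, h1 x]

/-- The total variation distance is bounded below through the states `{u > M}` from which it takes
long to hit `c`. -/
theorem surv_sub_le_tvDistAt (hP : IsBirthDeath P) (hπ : IsStationary P π) (c : Fin (N + 1))
    (n k : ℕ) {M : ℝ} (hM : 0 < M) :
    surv P c (n + k) 0 - M / (k + 1) - meanGreen (resistance P π) π c / M ≤ tvDistAt P π n := by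
  set u := green (resistance P π) π c 1 with hu
  set a : Fin (N + 1) → ℝ := fun x => if M < u x then 1 else 0 with ha
  have hk : (0 : ℝ) < k + 1 := by positivity
  -- From a state with `u x ≤ M`, Markov's inequality makes surviving `k` more steps unlikely.
  have h1 : surv P c k ≤ fun x => a x + M / (k + 1) := fun x => by
    simp only [ha]
    split_ifs with h
    · linarith [surv_le_one hP c k x, div_pos hM hk]
    · rw [zero_add, le_div_iff₀ hk, mul_comm]
      exact (mul_surv_le_green hP hπ c x k).trans (not_lt.1 h)
  have h2 : surv P c (n + k) 0 ≤ ∑ y, (P ^ n) 0 y * a y + M / (k + 1) := by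
    rw [surv_add]
    refine (killedOp_pow_le hP c (surv_nonneg hP c k) n 0).trans ?_
    calc _ ≤ ∑ y, (P ^ n) 0 y * (a y + M / (k + 1)) :=
          Finset.sum_le_sum fun y _ => mul_le_mul_of_nonneg_left (h1 y) ((pow_row hP n 0).1 y)
      _ = _ := by
          simp only [mul_add, Finset.sum_add_distrib, ← Finset.sum_mul, (pow_row hP n 0).2, one_mul]
  have h3 : ∑ x, π x * a x ≤ meanGreen (resistance P π) π c / M := by
    rw [← sum_green_one hπ.sum_eq_one, ← hu, le_div_iff₀ hM, Finset.sum_mul]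
    refine Finset.sum_le_sum fun x _ => ?_
    rw [mul_assoc]
    refine mul_le_mul_of_nonneg_left ?_ (hπ.nonneg x)
    simp only [ha]
    split_ifs with h
    · rw [one_mul]; exact h.le
    · rw [zero_mul]; exact green_one_nonneg hP hπ c x
  have h4 := sub_le_tvDist (pow_row hP n 0).2 hπ.sum_eq_one (a := a)
    (fun x => by simp only [ha]; split_ifs <;> simp)
    (fun x => by simp only [ha]; split_ifs <;> simp)
  rw [tvDistAt]
  linarith

end Killed

/-! ### Law, moments and tails of the actual hitting time. -/

section HittingTime

variable {N : ℕ} {P : Matrix (Fin (N + 1)) (Fin (N + 1)) ℝ} {π : Fin (N + 1) → ℝ}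
  {Ω : Type*} [MeasurableSpace Ω] {μ : Measure Ω} {X : ℕ → Ω → Fin (N + 1)}

/-- The weight of the path `s 0, …, s n` for the chain started at `0`. -/
noncomputable def pathWeight (P : Matrix (Fin (N + 1)) (Fin (N + 1)) ℝ) (n : ℕ)
    (s : ℕ → Fin (N + 1)) : ℝ :=
  if s 0 = 0 then ∏ i ∈ Finset.range n, P (s i) (s (i + 1)) else 0

theorem pathWeight_update (n : ℕ) (s : ℕ → Fin (N + 1)) (y : Fin (N + 1)) :
    pathWeight P (n + 1) (Function.update s (n + 1) y) = pathWeight P n s * P (s n) y := by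
  unfold pathWeight
  rw [Function.update_of_ne (by omega)]
  split_ifs
  · rw [Finset.prod_range_succ, Function.update_self, Function.update_of_ne (by omega)]
    congr 1
    refine Finset.prod_congr rfl fun i hi => ?_
    have := Finset.mem_range.1 hi
    rw [Function.update_of_ne (by omega), Function.update_of_ne (by omega)]
  · rw [zero_mul]

/-- The chain follows `s` up to time `n` and then avoids `c` up to time `n + k`. -/
def pathAvoid (X : ℕ → Ω → Fin (N + 1)) (c : Fin (N + 1)) (n k : ℕ) (s : ℕ → Fin (N + 1)) :
    Set Ω :=
  {ω | (∀ i ≤ n, X i ω = s i) ∧ ∀ i, n < i → i ≤ n + k → X i ω ≠ c}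

theorem measurableSet_pathAvoid (hX : ∀ n, Measurable (X n)) (c : Fin (N + 1)) (n k : ℕ)
    (s : ℕ → Fin (N + 1)) : MeasurableSet (pathAvoid X c n k s) := by
  have h1 : ∀ i y, MeasurableSet {ω | X i ω = y} := fun i y => hX i (measurableSet_singleton y)
  have : pathAvoid X c n k s = (⋂ i, ⋂ (_ : i ≤ n), {ω | X i ω = s i}) ∩
      ⋂ i, ⋂ (_ : n < i), ⋂ (_ : i ≤ n + k), {ω | X i ω = c}ᶜ := by
    ext ω; simp [pathAvoid]
  rw [this]
  exact (MeasurableSet.iInter fun i => MeasurableSet.iInter fun _ => h1 i _).inter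
    (MeasurableSet.iInter fun i => MeasurableSet.iInter fun _ => MeasurableSet.iInter fun _ =>
      (h1 i c).compl)

/-- Induction on `k` for all prefixes at once: splitting on `X (n + 1)` lengthens the prescribed
path by one, so path probabilities suffice and no conditioning is needed. -/
theorem measureReal_pathAvoid [IsProbabilityMeasure μ] (hX : IsMarkovChainFromZero P μ X)
    (c : Fin (N + 1)) (k : ℕ) : ∀ (n : ℕ) (s : ℕ → Fin (N + 1)), s n ≠ c →
      μ.real (pathAvoid X c n k s) = pathWeight P n s * surv P c k (s n) := by
  induction k with
  | zero =>
    intro n s hs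
    rw [surv_zero, offInd, if_neg hs, mul_one, pathWeight, ← hX.law n s]
    congr 1
    ext ω
    refine ⟨fun h => h.1, fun h => ⟨h, fun i h1 h2 => by omega⟩⟩
  | succ k ih =>
    intro n s hs
    have hsplit : μ.real (pathAvoid X c n (k + 1) s) =
        ∑ y, μ.real (pathAvoid X c n (k + 1) s ∩ {ω | X (n + 1) ω = y}) := by
      rw [← measureReal_biUnion_finset]
      · congr 1
        ext ω; simp
      · intro a _ b _ hab
        refine Set.disjoint_left.2 fun ω h1 h2 => hab ?_
        exact h1.2.symm.trans h2.2
      · intro y _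
        exact (measurableSet_pathAvoid hX.measurable c n (k + 1) s).inter
          (hX.measurable (n + 1) (measurableSet_singleton y))
    rw [hsplit, surv_succ, killedOp_apply, if_neg hs, Finset.mul_sum]
    refine Finset.sum_congr rfl fun y _ => ?_
    by_cases hy : y = c
    · rw [hy, surv_self, mul_zero, mul_zero]
      convert! measureReal_empty
      ext ω
      simp only [Set.mem_inter_iff, Set.mem_empty_iff_false, iff_false, not_and]
      intro h1
      exact h1.2 (n + 1) (by omega) (by omega)
    · have := ih (n + 1) (Function.update s (n + 1) y) (by rwa [Function.update_self])
      rw [pathWeight_update, Function.update_self, mul_assoc] at this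
      rw [← this]
      congr 1
      ext ω
      constructor
      · rintro ⟨⟨h1, h2⟩, h3⟩
        refine ⟨fun i hi => ?_, fun i hi hik => h2 i (by omega) (by omega)⟩
        rcases Nat.lt_or_eq_of_le hi with h | h
        · rw [Function.update_of_ne (by omega)]; exact h1 i (by omega)
        · rw [h, Function.update_self]; exact h3
      · rintro ⟨h1, h2⟩
        have h3 : X (n + 1) ω = y := by
          have := h1 (n + 1) le_rfl
          rwa [Function.update_self] at this
        refine ⟨⟨fun i hi => ?_, fun i hi hik => ?_⟩, h3⟩
        · have := h1 i (by omega)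
          rwa [Function.update_of_ne (by omega)] at this
        · rcases Nat.lt_or_eq_of_le (Nat.succ_le_of_lt hi) with h | h
          · exact h2 i h (by omega)
          · rw [← h]; exact h3 ▸ hy

theorem lt_hitTime_iff {S Ω' : Type*} (X : ℕ → Ω' → S) (c : S) (n : ℕ) (ω : Ω') :
    (n : WithTop ℕ) < hitTime X c ω ↔ ∀ i ≤ n, X i ω ≠ c := by
  rw [← not_le, hitTime]
  refine (not_congr (hittingAfter_le_iff (i := n))).trans ?_
  simp

theorem measureReal_lt_hitTime [IsProbabilityMeasure μ] (hX : IsMarkovChainFromZero P μ X)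
    {c : Fin (N + 1)} (hc : c ≠ 0) (n : ℕ) :
    μ.real {ω | (n : WithTop ℕ) < hitTime X c ω} = surv P c n 0 := by
  have h0 : μ.real {ω | X 0 ω = 0} = 1 := by
    have := hX.law 0 (fun _ => 0)
    simpa using this
  have h1 : ∀ᵐ ω ∂μ, X 0 ω = 0 := by
    refine (mem_ae_iff_prob_eq_one (hX.measurable 0 (measurableSet_singleton 0))).2 ?_
    exact (ENNReal.toReal_eq_one_iff _).1 h0
  have h2 := measureReal_pathAvoid hX c n 0 (fun _ => 0) hc.symm
  rw [pathWeight, if_pos rfl, Finset.prod_range_zero, one_mul] at h2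
  rw [← h2]
  refine measureReal_congr ?_
  filter_upwards [h1] with ω hω
  refine propext ((lt_hitTime_iff X c n ω).trans ⟨fun h => ?_, fun h i hi => ?_⟩)
  · exact ⟨fun i hi => by rw [Nat.le_zero.1 hi]; exact hω, fun i _ hi => h i (by omega)⟩
  · rcases Nat.eq_zero_or_pos i with h3 | h3
    · rw [h3, hω]; exact hc.symm
    · exact h.2 i h3 (by omega)

/-- Layer-cake formula: the sum over `n < T` is a series of indicators of `{n < T}`, integrated term
by term. -/
theorem integral_sum_range [IsProbabilityMeasure μ] {T : Ω → ℕ} (hT : Measurable T) {a : ℕ → ℝ}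
    (ha : ∀ n, 0 ≤ a n) {m : ℝ} (h : HasSum (fun n => a n * μ.real {ω | n < T ω}) m) :
    Integrable (fun ω => ∑ n ∈ Finset.range (T ω), a n) μ ∧
      ∫ ω, ∑ n ∈ Finset.range (T ω), a n ∂μ = m := by
  have hmeas : Measurable fun ω => ∑ n ∈ Finset.range (T ω), a n :=
    (measurable_from_nat (f := fun t : ℕ => ∑ n ∈ Finset.range t, a n)).comp hT
  have hset : ∀ n, MeasurableSet {ω | n < T ω} := fun n => measurableSet_lt measurable_const hT
  have hpt : ∀ ω, ENNReal.ofReal (∑ n ∈ Finset.range (T ω), a n) =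
      ∑' n, Set.indicator {ω | n < T ω} (fun _ => ENNReal.ofReal (a n)) ω := fun ω => by
    rw [ENNReal.ofReal_sum_of_nonneg fun n _ => ha n,
      tsum_eq_sum (s := Finset.range (T ω)) fun n hn => ?_]
    · refine Finset.sum_congr rfl fun n hn => ?_
      rw [Set.indicator_of_mem]
      exact Finset.mem_range.1 hn
    · rw [Set.indicator_of_notMem]
      exact fun h => hn (Finset.mem_range.2 h)
  have hlint : ∫⁻ ω, ENNReal.ofReal (∑ n ∈ Finset.range (T ω), a n) ∂μ = ENNReal.ofReal m := by
    simp only [hpt]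
    rw [lintegral_tsum fun n => (measurable_const.indicator (hset n)).aemeasurable, ← h.tsum_eq,
      ENNReal.ofReal_tsum_of_nonneg (fun n => mul_nonneg (ha n) measureReal_nonneg) h.summable]
    refine tsum_congr fun n => ?_
    rw [lintegral_indicator_const (hset n), ENNReal.ofReal_mul (ha n), ofReal_measureReal]
  have h0 : ∀ ω, 0 ≤ ∑ n ∈ Finset.range (T ω), a n := fun ω => Finset.sum_nonneg fun n _ => ha n
  constructor
  · refine ⟨hmeas.aestronglyMeasurable, ?_⟩
    rw [hasFiniteIntegral_iff_ofReal (Eventually.of_forall h0), hlint]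
    exact ENNReal.ofReal_lt_top
  · rw [integral_eq_lintegral_of_nonneg_ae (Eventually.of_forall h0) hmeas.aestronglyMeasurable,
      hlint, ENNReal.toReal_ofReal]
    exact h.nonneg fun n => mul_nonneg (ha n) measureReal_nonneg

theorem sum_range_odd (t : ℕ) : ∑ n ∈ Finset.range t, (2 * ((n : ℝ) + 1) - 1) = (t : ℝ) ^ 2 := by
  induction t with
  | zero => simp
  | succ t ih => rw [Finset.sum_range_succ, ih]; push_cast; ring

theorem measurable_hitTime (hX : ∀ n, Measurable (X n)) (c : Fin (N + 1)) (n : ℕ) :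
    MeasurableSet {ω | (n : WithTop ℕ) < hitTime X c ω} := by
  have : {ω | (n : WithTop ℕ) < hitTime X c ω} = ⋂ i, ⋂ (_ : i ≤ n), {ω | X i ω = c}ᶜ := by
    ext ω
    simp [lt_hitTime_iff]
  rw [this]
  exact MeasurableSet.iInter fun i => MeasurableSet.iInter fun _ =>
    (hX i (measurableSet_singleton c)).compl

theorem ae_hitTime_ne_top [IsProbabilityMeasure μ] (hP : IsBirthDeath P) (hπ : IsStationary P π)
    (hX : IsMarkovChainFromZero P μ X) {c : Fin (N + 1)} (hc : c ≠ 0) :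
    ∀ᵐ ω ∂μ, hitTime X c ω ≠ ⊤ := by
  have h1 : μ.real {ω | hitTime X c ω = ⊤} ≤ 0 := by
    refine ge_of_tendsto' (tendsto_surv hP hπ c 0) fun n => ?_
    rw [← measureReal_lt_hitTime hX hc n]
    refine measureReal_mono fun ω hω => ?_
    rw [Set.mem_ofPred_eq] at hω ⊢
    rw [hω]; exact WithTop.coe_lt_top n
  rw [ae_iff]
  simp only [ne_eq, not_not]
  exact (measureReal_eq_zero_iff).1 (le_antisymm h1 measureReal_nonneg)

/-- The hitting time with values in `ℕ`. -/
noncomputable def hitTimeNat {S Ω' : Type*} (X : ℕ → Ω' → S) (c : S) (ω : Ω') : ℕ :=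
  (hitTime X c ω).untopD 0

theorem lt_hitTimeNat_iff {Ω' : Type*} {X : ℕ → Ω' → Fin (N + 1)} {c : Fin (N + 1)} {ω : Ω'}
    (n : ℕ) :
    n < hitTimeNat X c ω ↔ (n : WithTop ℕ) < hitTime X c ω ∧ hitTime X c ω ≠ ⊤ := by
  unfold hitTimeNat
  cases h : hitTime X c ω with
  | top => simp
  | coe t =>
    simp only [WithTop.coe_ne_top, not_false_eq_true, ne_eq, and_true]
    exact WithTop.coe_lt_coe.symm

theorem measurable_hitTimeNat (hX : ∀ n, Measurable (X n)) (c : Fin (N + 1)) :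
    Measurable (hitTimeNat X c) := by
  have htop : MeasurableSet {ω | hitTime X c ω = ⊤} := by
    have : {ω | hitTime X c ω = ⊤} = ⋂ n : ℕ, {ω | (n : WithTop ℕ) < hitTime X c ω} := by
      ext ω
      simp only [Set.mem_ofPred_eq, Set.mem_iInter]
      refine ⟨fun h n => h ▸ WithTop.coe_lt_top n, fun h => ?_⟩
      by_contra h1
      obtain ⟨t, ht⟩ := WithTop.ne_top_iff_exists.1 h1
      exact absurd (h t) (by rw [← ht]; exact lt_irrefl _)
    rw [this]
    exact MeasurableSet.iInter fun n => measurable_hitTime hX c n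
  refine measurable_of_Ioi fun n => ?_
  have : hitTimeNat X c ⁻¹' Set.Ioi n =
      {ω | (n : WithTop ℕ) < hitTime X c ω} ∩ {ω | hitTime X c ω = ⊤}ᶜ := by
    ext ω
    exact lt_hitTimeNat_iff n
  rw [this]
  exact (measurable_hitTime hX c n).inter htop.compl

theorem measureReal_lt_hitTimeNat [IsProbabilityMeasure μ] (hP : IsBirthDeath P)
    (hπ : IsStationary P π) (hX : IsMarkovChainFromZero P μ X) {c : Fin (N + 1)} (hc : c ≠ 0)
    (n : ℕ) : μ.real {ω | n < hitTimeNat X c ω} = surv P c n 0 := by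
  rw [← measureReal_lt_hitTime hX hc n]
  refine measureReal_congr ?_
  filter_upwards [ae_hitTime_ne_top hP hπ hX hc] with ω hω
  exact propext ((lt_hitTimeNat_iff n).trans (and_iff_left hω))

/-- The first two moments of the hitting time. -/
theorem hitTimeReal_moments [IsProbabilityMeasure μ] (hP : IsBirthDeath P)
    (hπ : IsStationary P π) (hX : IsMarkovChainFromZero P μ X) {c : Fin (N + 1)} (hc : c ≠ 0) :
    MemLp (hitTimeReal X c) 2 μ ∧ meanHit μ X c = leftTrace (resistance P π) π c ∧
      ProbabilityTheory.variance (hitTimeReal X c) μ = leftVar P π c := by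
  have hT := measurable_hitTimeNat hX.measurable c
  have h1 := integral_sum_range (μ := μ) hT (a := fun _ => 1) (fun _ => zero_le_one)
    (m := green (resistance P π) π c 1 0) (by
      simp only [one_mul, measureReal_lt_hitTimeNat hP hπ hX hc]
      exact hasSum_surv hP hπ c 0)
  -- The first `T` odd numbers add up to `T²`; this form splits into the two series already summed.
  have h2 := integral_sum_range (μ := μ) hT (a := fun n => 2 * ((n : ℝ) + 1) - 1)
    (fun n => by have : (0 : ℝ) ≤ n := n.cast_nonneg; linarith)
    (m := 2 * green (resistance P π) π c (green (resistance P π) π c 1) 0 -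
      green (resistance P π) π c 1 0) (by
      simp only [measureReal_lt_hitTimeNat hP hπ hX hc, sub_mul, one_mul, mul_assoc]
      exact ((hasSum_succ_mul_surv hP hπ c 0).mul_left 2).sub (hasSum_surv hP hπ c 0))
  simp only [Finset.sum_const, Finset.card_range, nsmul_eq_mul, mul_one, sum_range_odd] at h1 h2
  have hmem : MemLp (hitTimeReal X c) 2 μ :=
    (memLp_two_iff_integrable_sq h1.1.aestronglyMeasurable).2 h2.1
  have hmean : meanHit μ X c = leftTrace (resistance P π) π c := by
    rw [← green_one_zero hπ.sum_eq_one]; exact h1.2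
  refine ⟨hmem, hmean, ?_⟩
  have h3 : ∫ ω, hitTimeReal X c ω ∂μ = leftTrace (resistance P π) π c := hmean
  have h4 : ∫ ω, hitTimeReal X c ω ^ 2 ∂μ = _ := h2.2
  rw [ProbabilityTheory.variance_eq_sub hmem, h3]
  simp only [Pi.pow_apply]
  rw [h4, two_mul_green_green_zero, green_one_zero hπ.sum_eq_one, leftVar]
  ring

/-- Chebyshev's inequality for the upper tail of the hitting time. -/
theorem surv_le_div_sq [IsProbabilityMeasure μ] (hP : IsBirthDeath P)
    (hπ : IsStationary P π) (hX : IsMarkovChainFromZero P μ X) {c : Fin (N + 1)} (hc : c ≠ 0)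
    {n : ℕ} {b : ℝ} (hb : 0 < b) (hn : meanHit μ X c + b ≤ n + 1) :
    surv P c n 0 ≤ leftVar P π c / b ^ 2 := by
  obtain ⟨hmem, -, hvar⟩ := hitTimeReal_moments hP hπ hX hc
  have hcheb := ProbabilityTheory.meas_ge_le_variance_div_sq hmem hb
  rw [hvar] at hcheb
  rw [← measureReal_lt_hitTimeNat hP hπ hX hc]
  refine ENNReal.toReal_le_of_le_ofReal
    (div_nonneg (leftVar_nonneg hP hπ c) (sq_nonneg b)) (le_trans (measure_mono ?_) hcheb)
  intro ω hω
  -- Integrality gains the extra unit in `hn`, which later absorbs the rounding by `⌊·⌋₊`.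
  have h1 : (n : ℝ) + 1 ≤ hitTimeReal X c ω := by
    have : n + 1 ≤ hitTimeNat X c ω := hω
    have h2 : ((n + 1 : ℕ) : ℝ) ≤ (hitTimeNat X c ω : ℝ) := Nat.cast_le.2 this
    rwa [Nat.cast_succ] at h2
  have h2 : b ≤ hitTimeReal X c ω - meanHit μ X c := by linarith
  exact h2.trans (le_abs_self _)

/-- Chebyshev's inequality for the lower tail of the hitting time. -/
theorem one_sub_div_sq_le_surv [IsProbabilityMeasure μ] (hP : IsBirthDeath P)
    (hπ : IsStationary P π) (hX : IsMarkovChainFromZero P μ X) {c : Fin (N + 1)} (hc : c ≠ 0)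
    {n : ℕ} {b : ℝ} (hb : 0 < b) (hn : n ≤ meanHit μ X c - b) :
    1 - leftVar P π c / b ^ 2 ≤ surv P c n 0 := by
  obtain ⟨hmem, -, hvar⟩ := hitTimeReal_moments hP hπ hX hc
  have hcheb := ProbabilityTheory.meas_ge_le_variance_div_sq hmem hb
  rw [hvar] at hcheb
  have hset : MeasurableSet {ω | n < hitTimeNat X c ω} :=
    measurableSet_lt measurable_const (measurable_hitTimeNat hX.measurable c)
  rw [← measureReal_lt_hitTimeNat hP hπ hX hc, sub_le_comm, ← probReal_compl_eq_one_sub hset]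
  refine ENNReal.toReal_le_of_le_ofReal
    (div_nonneg (leftVar_nonneg hP hπ c) (sq_nonneg b)) (le_trans (measure_mono ?_) hcheb)
  intro ω hω
  have h1 : hitTimeReal X c ω ≤ n := by
    have : hitTimeNat X c ω ≤ n := not_lt.1 hω
    exact Nat.cast_le.2 this
  have h2 : b ≤ -(hitTimeReal X c ω - meanHit μ X c) := by linarith
  exact h2.trans (neg_le_abs _)

end HittingTime

/-! ### From tail bounds to cutoff and windows. -/

section Asymptotics

/-- Quantitative form of a cutoff at `t` with window `s`. -/
def HasWindowBound (d : ℕ → ℕ → ℝ) (t s : ℕ → ℝ) : Prop :=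
  ∃ η : ℝ → ℝ, Tendsto η atTop (𝓝 0) ∧ ∃ γ₀ : ℝ, ∀ᶠ N in atTop, 0 < s N ∧ ∀ γ, γ₀ < γ → ∀ n : ℕ,
    ((n : ℝ) ≤ t N - γ * s N → 1 - η γ ≤ d N n) ∧ (t N + γ * s N ≤ n + 1 → d N n ≤ η γ)

variable {d : ℕ → ℕ → ℝ} {t s : ℕ → ℝ}

/-- Moving the centre by at most `B` windows costs a shift of `γ` by `B`. -/
theorem HasWindowBound.congr_center (h : HasWindowBound d t s) {t' : ℕ → ℝ} {B : ℝ}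
    (hB : ∀ᶠ N in atTop, |t N - t' N| ≤ B * s N) : HasWindowBound d t' s := by
  obtain ⟨η, hη, γ₀, hb⟩ := h
  refine ⟨fun γ => η (γ - B), hη.comp (tendsto_atTop_add_const_right _ (-B) tendsto_id), γ₀ + B, ?_⟩
  filter_upwards [hb, hB] with N hN hBN
  refine ⟨hN.1, fun γ hγ n => ?_⟩
  have hγ' : γ₀ < γ - B := by linarith
  obtain ⟨h1, h2⟩ := abs_le.1 hBN
  exact ⟨fun hn => (hN.2 _ hγ' n).1 (by linarith), fun hn => (hN.2 _ hγ' n).2 (by linarith)⟩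

theorem HasWindowBound.isCutoffWithWindow (h : HasWindowBound d t s) (ho : s =o[atTop] t)
    (ht : ∀ᶠ N in atTop, 0 < t N) (hd : ∀ᶠ N in atTop, ∀ n, 0 ≤ d N n ∧ d N n ≤ 1) :
    IsCutoffWithWindow d t s := by
  obtain ⟨η, hη, γ₀, hb⟩ := h
  refine ⟨ho, ?_, ?_⟩
  · have hle : ∀ γ : ℝ, ∀ᶠ N in atTop, d N ⌊t N - γ * s N⌋₊ ≤ 1 := fun γ =>
      hd.mono fun N hN => (hN _).2
    have hge : ∀ γ : ℝ, ∀ᶠ N in atTop, 0 ≤ d N ⌊t N - γ * s N⌋₊ := fun γ =>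
      hd.mono fun N hN => (hN _).1
    have hlow : ∀ᶠ γ in atTop, 1 - η γ ≤ liminf (fun N => d N ⌊t N - γ * s N⌋₊) atTop := by
      filter_upwards [eventually_gt_atTop γ₀, eventually_gt_atTop 0] with γ hγ hγ0
      refine le_liminf_of_le (isCoboundedUnder_ge_of_eventually_le atTop (hle γ)) ?_
      -- Since `s = o(t)`, the time `t N - γ * s N` is eventually nonnegative, so the natural floor
      -- does not exceed it.
      filter_upwards [hb, ht, isLittleO_iff.1 ho (inv_pos.2 hγ0)] with N hN htN hs
      refine ((hN.2 γ hγ _).1 (Nat.floor_le ?_))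
      rw [Real.norm_eq_abs, Real.norm_eq_abs, abs_of_pos hN.1, abs_of_pos htN,
        inv_mul_eq_div, le_div_iff₀ hγ0] at hs
      linarith
    have hup : ∀ γ : ℝ, liminf (fun N => d N ⌊t N - γ * s N⌋₊) atTop ≤ 1 := fun γ =>
      liminf_le_of_frequently_le (hle γ).frequently (isBoundedUnder_of_eventually_ge (hge γ))
    refine tendsto_of_tendsto_of_tendsto_of_le_of_le' (g := fun γ => 1 - η γ) ?_
      tendsto_const_nhds hlow (Eventually.of_forall hup)
    simpa using hη.const_sub 1
  · have hle : ∀ γ : ℝ, ∀ᶠ N in atTop, d N ⌊t N + γ * s N⌋₊ ≤ 1 := fun γ =>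
      hd.mono fun N hN => (hN _).2
    have hge : ∀ γ : ℝ, ∀ᶠ N in atTop, 0 ≤ d N ⌊t N + γ * s N⌋₊ := fun γ =>
      hd.mono fun N hN => (hN _).1
    have hup : ∀ᶠ γ in atTop, limsup (fun N => d N ⌊t N + γ * s N⌋₊) atTop ≤ η γ := by
      filter_upwards [eventually_gt_atTop γ₀] with γ hγ
      refine limsup_le_of_le (isCoboundedUnder_le_of_eventually_le atTop (hge γ)) ?_
      filter_upwards [hb] with N hN
      exact (hN.2 γ hγ _).2 (Nat.lt_floor_add_one _).le
    have hlow : ∀ γ : ℝ, 0 ≤ limsup (fun N => d N ⌊t N + γ * s N⌋₊) atTop := fun γ =>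
      le_limsup_of_frequently_le (hge γ).frequently (isBoundedUnder_of_eventually_le (hle γ))
    exact tendsto_of_tendsto_of_tendsto_of_le_of_le' tendsto_const_nhds hη
      (Eventually.of_forall hlow) hup

theorem HasWindowBound.isCutoff (h : HasWindowBound d t s) (ho : s =o[atTop] t)
    (ht : ∀ᶠ N in atTop, 0 < t N) (hd : ∀ᶠ N in atTop, ∀ n, 0 ≤ d N n ∧ d N n ≤ 1) :
    IsCutoff d t := by
  obtain ⟨η, hη, γ₀, hb⟩ := h
  have hγ : ∀ e : ℝ, 0 < e → ∃ γ, γ₀ < γ ∧ 0 < γ ∧ η γ < e := fun e he =>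
    ((eventually_gt_atTop γ₀).and ((eventually_gt_atTop 0).and (hη.eventually_lt_const he))).exists
  have hs : ∀ γ a : ℝ, 0 < γ → 0 < a → ∀ᶠ N in atTop, γ * s N ≤ a * t N := fun γ a hγ ha => by
    filter_upwards [hb, ht, isLittleO_iff.1 ho (div_pos ha hγ)] with N hN htN hs
    rw [Real.norm_eq_abs, Real.norm_eq_abs, abs_of_pos hN.1, abs_of_pos htN,
      div_mul_eq_mul_div, le_div_iff₀ hγ] at hs
    linarith
  constructor
  · intro c hc
    refine tendsto_order.2 ⟨fun e he => ?_, fun e he => ?_⟩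
    · filter_upwards [hd] with N hN using he.trans_le (hN _).1
    · obtain ⟨γ, h1, h2, h3⟩ := hγ e he
      filter_upwards [hb, hs γ (c - 1) h2 (sub_pos.2 hc)] with N hN hsN
      refine ((hN.2 γ h1 _).2 ?_).trans_lt h3
      have := (Nat.lt_floor_add_one (c * t N)).le
      linarith
  · intro c hc0 hc
    refine tendsto_order.2 ⟨fun e he => ?_, fun e he => ?_⟩
    · obtain ⟨γ, h1, h2, h3⟩ := hγ (1 - e) (sub_pos.2 he)
      filter_upwards [hb, ht, hs γ (1 - c) h2 (sub_pos.2 hc)] with N hN htN hsN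
      refine lt_of_lt_of_le (by linarith) ((hN.2 γ h1 ⌊c * t N⌋₊).1 ?_)
      have := Nat.floor_le (mul_nonneg hc0 htN.le)
      linarith
    · filter_upwards [hd] with N hN using (hN _).2.trans_lt he

variable {v τ : ℕ → ℝ} {C : ℝ}

/-- A window bound from Chebyshev-type bounds with mean `t`, variance `v` and relaxation
time `τ`. -/
theorem hasWindowBound_of_tails (hC : 0 ≤ C)
    (hU : ∀ᶠ N in atTop, ∀ (n : ℕ) (b : ℝ), 0 < b → t N + b ≤ n + 1 → d N n ≤ v N / b ^ 2)
    (hL : ∀ᶠ N in atTop, ∀ (n k : ℕ) (b M : ℝ), 0 < b → 0 < M → (n : ℝ) + k ≤ t N - b →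
      1 - v N / b ^ 2 - M / (k + 1) - C * τ N / M ≤ d N n) {A : ℝ}
    (hs : ∀ᶠ N in atTop, 0 < s N) (hv : ∀ᶠ N in atTop, v N ≤ A * s N ^ 2)
    (hτ : ∀ᶠ N in atTop, τ N ≤ A * s N) : HasWindowBound d t s := by
  refine ⟨fun γ => max (A / γ ^ 2) (4 * A / γ ^ 2 + (4 + C * A) / √γ), ?_, 0, ?_⟩
  · have h1 : Tendsto (fun γ : ℝ => γ ^ 2) atTop atTop := tendsto_pow_atTop two_ne_zero
    have h2 := (h1.const_div_atTop A).max ((h1.const_div_atTop (4 * A)).add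
      (Real.tendsto_sqrt_atTop.const_div_atTop (4 + C * A)))
    simpa using h2
  filter_upwards [hU, hL, hs, hv, hτ] with N hUN hLN hsN hvN hτN
  refine ⟨hsN, fun γ hγ n => ⟨fun hn => ?_, fun hn => ?_⟩⟩
  · have hγs : 0 < γ * s N := mul_pos hγ hsN
    have hsq : 0 < √γ := Real.sqrt_pos.2 hγ
    have hk := Nat.floor_le (div_nonneg hγs.le (by norm_num : (0 : ℝ) ≤ 4))
    have hk1 := Nat.lt_floor_add_one (γ * s N / 4)
    -- The gap `γ s` leaves room for `k ≈ γ s / 4` and `b = γ s / 2`. The threshold `M = √γ s` lies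
    -- between the scales `τ = O(s)` and `k`, so that `M / (k + 1)` and `τ / M` are both `O(1 /
    -- √γ)`.
    have h := hLN n ⌊γ * s N / 4⌋₊ (γ * s N / 2) (√γ * s N) (by linarith) (mul_pos hsq hsN)
      (by linarith)
    have e1 : v N / (γ * s N / 2) ^ 2 ≤ 4 * A / γ ^ 2 := by
      rw [div_le_div_iff₀ (by positivity) (by positivity)]
      nlinarith [mul_le_mul_of_nonneg_right hvN (sq_nonneg γ)]
    have e2 : √γ * s N / (⌊γ * s N / 4⌋₊ + 1) ≤ 4 / √γ := by
      rw [div_le_div_iff₀ (by positivity) hsq, mul_right_comm, Real.mul_self_sqrt hγ.le]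
      linarith
    have e3 : C * τ N / (√γ * s N) ≤ C * A / √γ := by
      rw [div_le_div_iff₀ (by positivity) hsq]
      nlinarith [mul_le_mul_of_nonneg_left hτN (mul_nonneg hC hsq.le)]
    have e4 : (4 + C * A) / √γ = 4 / √γ + C * A / √γ := add_div _ _ _
    have e5 := le_max_right (A / γ ^ 2) (4 * A / γ ^ 2 + (4 + C * A) / √γ)
    linarith
  · refine (hUN n (γ * s N) (mul_pos hγ hsN) hn).trans (le_trans ?_ (le_max_left _ _))
    rw [mul_pow, div_le_div_iff₀ (by positivity) (by positivity)]
    nlinarith [mul_le_mul_of_nonneg_right hvN (sq_nonneg γ)]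

variable {S V : ℕ → ℝ}

theorem isLittleO_sqrt_mul (hτ : ∀ᶠ N in atTop, 0 < τ N)
    (h5 : ∀ K : ℝ, ∀ᶠ N in atTop, K * τ N ≤ S N) :
    (fun N => √(τ N * S N)) =o[atTop] S := by
  refine isLittleO_iff.2 fun e he => ?_
  filter_upwards [hτ, h5 (1 / e ^ 2)] with N hτN hK
  have hS : 0 < S N := lt_of_lt_of_le (by positivity) hK
  rw [Real.norm_eq_abs, Real.norm_eq_abs, abs_of_nonneg (Real.sqrt_nonneg _), abs_of_pos hS]
  refine Real.sqrt_le_iff.2 ⟨by positivity, ?_⟩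
  rw [one_div_mul_eq_div, div_le_iff₀ (by positivity)] at hK
  nlinarith

/-- Without a lower bound on `V`, the window `√(τ S)` works: it dominates `τ`, its square dominates
`v`, and it is `o(S)`. If `V ≥ c τ²`, then `τ` is absorbed by `√v` and by `√V`, which become
admissible windows. -/
theorem cutoff_of_tails (hC : 0 < C)
    (hd : ∀ᶠ N in atTop, ∀ n, 0 ≤ d N n ∧ d N n ≤ 1)
    (hU : ∀ᶠ N in atTop, ∀ (n : ℕ) (b : ℝ), 0 < b → t N + b ≤ n + 1 → d N n ≤ v N / b ^ 2)
    (hL : ∀ᶠ N in atTop, ∀ (n k : ℕ) (b M : ℝ), 0 < b → 0 < M → (n : ℝ) + k ≤ t N - b →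
      1 - v N / b ^ 2 - M / (k + 1) - C * τ N / M ≤ d N n)
    (hτ : ∀ᶠ N in atTop, 0 < τ N)
    (h1 : ∀ᶠ N in atTop, |t N - 1 / 2 * S N| ≤ C * τ N)
    (h2 : ∀ᶠ N in atTop, V N ≤ 2 * v N)
    (h3 : ∀ᶠ N in atTop, v N ≤ V N + C * τ N ^ 2)
    (h4 : ∀ᶠ N in atTop, V N ≤ τ N * S N)
    (h5 : ∀ K : ℝ, ∀ᶠ N in atTop, K * τ N ≤ S N) :
    IsCutoff d t ∧ Asymptotics.IsEquivalent atTop t (fun N => 1 / 2 * S N) ∧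
      ((∃ c : ℝ, 0 < c ∧ ∀ᶠ N in atTop, c * τ N ^ 2 ≤ V N) →
        IsCutoffWithWindow d t (fun N => √(v N)) ∧
        IsCutoffWithWindow d (fun N => 1 / 2 * S N) (fun N => 1 / 2 * √(V N))) := by
  have hSpos : ∀ᶠ N in atTop, 0 < 1 / 2 * S N := by
    filter_upwards [hτ, h5 1] with N h h'
    linarith
  have hequiv : Asymptotics.IsEquivalent atTop t (fun N => 1 / 2 * S N) := by
    refine isLittleO_iff.2 fun e he => ?_
    filter_upwards [hτ, h1, h5 (2 * C / e), hSpos] with N hτN h1N h5N hS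
    rw [Pi.sub_apply, Real.norm_eq_abs, Real.norm_eq_abs, abs_of_pos hS]
    refine h1N.trans ?_
    rw [div_mul_eq_mul_div, div_le_iff₀ he] at h5N
    linarith
  have htpos : ∀ᶠ N in atTop, 0 < t N := by
    filter_upwards [hτ, h1, h5 (2 * C + 1)] with N hτN h1N h5N
    have := (abs_le.1 h1N).1
    nlinarith
  have hos : (fun N => √(τ N * S N)) =o[atTop] fun N => 1 / 2 * S N :=
    (isLittleO_sqrt_mul hτ h5).trans_isBigO
      (isBigO_const_mul_self 2 (fun N => 1 / 2 * S N) atTop |>.congr_left fun N => by ring)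
  have hot := hos.trans_isBigO hequiv.symm.isBigO
  have hτs : ∀ᶠ N in atTop, τ N ≤ √(τ N * S N) := by
    filter_upwards [hτ, h5 1] with N hτN h5N
    exact Real.le_sqrt_of_sq_le (by nlinarith)
  have hvs : ∀ᶠ N in atTop, v N ≤ (1 + C) * √(τ N * S N) ^ 2 := by
    filter_upwards [hτ, h3, h4, h5 1] with N hτN h3N h4N h5N
    rw [Real.sq_sqrt (by nlinarith)]
    nlinarith [mul_le_mul_of_nonneg_left h5N (mul_pos hC hτN).le]
  refine ⟨?_, hequiv, ?_⟩
  · refine HasWindowBound.isCutoff (hasWindowBound_of_tails (s := fun N => √(τ N * S N))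
      hC.le hU hL (A := 1 + C) ?_ hvs ?_) hot htpos hd
    · filter_upwards [hτ, hSpos] with N hτN hS
      exact Real.sqrt_pos.2 (mul_pos hτN (by linarith))
    · filter_upwards [hτs] with N hN
      nlinarith [Real.sqrt_nonneg (τ N * S N)]
  · rintro ⟨c, hc, hcV⟩
    have hVpos : ∀ᶠ N in atTop, 0 < V N := by
      filter_upwards [hτ, hcV] with N hτN hN
      exact lt_of_lt_of_le (by positivity) hN
    have hvpos : ∀ᶠ N in atTop, 0 < v N := by
      filter_upwards [hVpos, h2] with N h h'
      linarith
    have hτV : ∀ᶠ N in atTop, τ N ≤ √(1 / c) * √(V N) := by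
      filter_upwards [hcV] with N hN
      rw [← Real.sqrt_mul (by positivity), one_div_mul_eq_div]
      exact Real.le_sqrt_of_sq_le ((le_div_iff₀ hc).2 (by linarith))
    have hτv : ∀ᶠ N in atTop, τ N ≤ √(2 / c) * √(v N) := by
      filter_upwards [hcV, h2] with N hN h2N
      rw [← Real.sqrt_mul (by positivity), div_mul_eq_mul_div]
      exact Real.le_sqrt_of_sq_le ((le_div_iff₀ hc).2 (by linarith))
    constructor
    · refine HasWindowBound.isCutoffWithWindow (hasWindowBound_of_tails (s := fun N => √(v N))
        hC.le hU hL (A := max 1 √(2 / c)) ?_ ?_ ?_) ?_ htpos hd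
      · filter_upwards [hvpos] with N hN using Real.sqrt_pos.2 hN
      · filter_upwards [hvpos] with N hN
        rw [Real.sq_sqrt hN.le]
        exact le_mul_of_one_le_left hN.le (le_max_left _ _)
      · filter_upwards [hτv] with N hN
        exact hN.trans (mul_le_mul_of_nonneg_right (le_max_right _ _) (Real.sqrt_nonneg _))
      · refine IsBigO.trans_isLittleO (IsBigO.of_bound √(1 + C) ?_) hot
        filter_upwards [hvs] with N hN
        rw [Real.norm_eq_abs, Real.norm_eq_abs, abs_of_nonneg (Real.sqrt_nonneg _),
          abs_of_nonneg (Real.sqrt_nonneg _)]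
        refine (Real.sqrt_le_sqrt hN).trans (le_of_eq ?_)
        rw [Real.sqrt_mul (by positivity), Real.sqrt_sq (Real.sqrt_nonneg _)]
    -- The bound is proved around `t`, then recentred at `S / 2`, which is within `C τ = O(√V)` of
    -- `t`.
    · have hW : HasWindowBound d t (fun N => 1 / 2 * √(V N)) := by
        refine hasWindowBound_of_tails hC.le hU hL (A := max (4 * (1 + C / c)) (2 * √(1 / c)))
          ?_ ?_ ?_
        · filter_upwards [hVpos] with N hN
          have := Real.sqrt_pos.2 hN
          linarith
        · filter_upwards [hVpos, h3, hcV] with N hN h3N hcN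
          have e1 : C * τ N ^ 2 ≤ C / c * V N := by
            rw [div_mul_eq_mul_div, le_div_iff₀ hc]
            nlinarith [mul_le_mul_of_nonneg_left hcN hC.le]
          have e2 : (1 / 2 * √(V N)) ^ 2 = V N / 4 := by
            rw [mul_pow, Real.sq_sqrt hN.le]; ring
          rw [e2]
          have e3 := mul_le_mul_of_nonneg_right
            (le_max_left (4 * (1 + C / c)) (2 * √(1 / c))) (div_nonneg hN.le zero_le_four)
          linarith
        · filter_upwards [hτV] with N hN
          have e3 := mul_le_mul_of_nonneg_right
            (le_max_right (4 * (1 + C / c)) (2 * √(1 / c)))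
            (mul_nonneg one_half_pos.le (Real.sqrt_nonneg (V N)))
          linarith
      refine (hW.congr_center (B := 2 * C * √(1 / c)) ?_).isCutoffWithWindow ?_ hSpos hd
      · filter_upwards [h1, hτV] with N h1N hN
        nlinarith [mul_le_mul_of_nonneg_left hN hC.le]
      · refine IsBigO.trans_isLittleO (IsBigO.of_bound 1 ?_) hos
        filter_upwards [h4] with N hN
        rw [Real.norm_eq_abs, Real.norm_eq_abs, abs_of_nonneg (by positivity),
          abs_of_nonneg (Real.sqrt_nonneg _)]
        have := Real.sqrt_le_sqrt hN
        linarith [Real.sqrt_nonneg (V N)]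

end Asymptotics

/-! ### Mass on the two sides of the halting state. -/

section Middle

variable {N : ℕ} {P : Matrix (Fin (N + 1)) (Fin (N + 1)) ℝ} {π : Fin (N + 1) → ℝ}

theorem xStar_ne_zero (hN : 1 ≤ N) : xStar N ≠ 0 := by
  intro h
  have := xStar_val N hN
  rw [h, Fin.val_zero] at this
  omega

theorem xStar_rev_le (hN : 1 ≤ N) : (xStar N).rev ≤ xStar N := by
  rw [Fin.le_def, Fin.val_rev, xStar_val N hN]
  omega

/-- The states split into those from `xStar N` on, their mirror images, and the middle state when
`N` is even. The two outer blocks have equal mass; `min δ 1` also covers odd `N`, with no middle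
state. -/
theorem leftMass_xStar (hP : IsBirthDeath P) (hs : IsSymmetricChain P) (hπ : IsStationary P π)
    (hN : 1 ≤ N) {δ : ℝ} (hmid : ∀ x : Fin (N + 1), 2 * (x : ℕ) = N → π x ≤ 1 - δ) :
    min δ 1 / 2 ≤ leftMass π (xStar N) ∧ min δ 1 / 2 ≤ 1 - leftMass π (xStar N) := by
  have hpart : ∀ x : Fin (N + 1), 1 = (1 - leftInd (xStar N) x) + (1 - leftInd (xStar N) x.rev) +
      if 2 * (x : ℕ) = N then 1 else 0 := fun x => by
    have h1 := xStar_val N hN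
    have h2 := x.2
    simp only [leftInd, Fin.lt_def, Fin.val_rev, h1]
    split_ifs <;> first | omega | norm_num
  have hsum : 2 * (1 - leftMass π (xStar N)) + ∑ x : Fin (N + 1), π x *
      (if 2 * (x : ℕ) = N then 1 else 0) = 1 := by
    have h1 : ∑ x, π x * (1 - leftInd (xStar N) x.rev) = 1 - leftMass π (xStar N) := by
      rw [leftMass_eq_sub hπ, ← Equiv.sum_comp Fin.revPerm]
      simp only [Fin.revPerm_apply, hπ.rev_eq hP hs, Fin.rev_rev]
    have h2 : ∑ x, π x = ∑ x, π x * ((1 - leftInd (xStar N) x) +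
        (1 - leftInd (xStar N) x.rev) + if 2 * (x : ℕ) = N then 1 else 0) :=
      Finset.sum_congr rfl fun x _ => by rw [← hpart x, mul_one]
    simp only [mul_add, Finset.sum_add_distrib, h1, ← leftMass_eq_sub hπ, hπ.sum_eq_one] at h2
    linarith
  have hnn : 0 ≤ ∑ x : Fin (N + 1), π x * (if 2 * (x : ℕ) = N then 1 else 0) :=
    Finset.sum_nonneg fun x _ => mul_nonneg (hπ.nonneg x) (by split_ifs <;> simp)
  have hle : ∑ x : Fin (N + 1), π x * (if 2 * (x : ℕ) = N then 1 else 0) ≤ 1 - min δ 1 := by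
    by_cases h : ∃ x : Fin (N + 1), 2 * (x : ℕ) = N
    · obtain ⟨x, hx⟩ := h
      rw [Finset.sum_eq_single x (fun y _ hy => ?_) (by simp), if_pos hx, mul_one]
      · linarith [hmid x hx, min_le_left δ 1]
      · rw [if_neg fun h => hy (Fin.ext (by omega)), mul_zero]
    · rw [Finset.sum_eq_zero fun x _ => by rw [if_neg fun h' => h ⟨x, h'⟩, mul_zero]]
      linarith [min_le_right δ 1]
  have := min_le_right δ 1
  constructor <;> linarith

end Middle

end BDCutoff

/-! ### Assembly of the estimates. -/

theorem mainTheorem9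
    (P : (N : ℕ) → Matrix (Fin (N + 1)) (Fin (N + 1)) ℝ)
    (π : (N : ℕ) → Fin (N + 1) → ℝ)
    (lam : ℕ → ℕ → ℝ)
    (Ω : ℕ → Type*) [∀ N, MeasurableSpace (Ω N)]
    (μ : (N : ℕ) → Measure (Ω N)) [∀ N, IsProbabilityMeasure (μ N)]
    (X : (N : ℕ) → ℕ → Ω N → Fin (N + 1))
    (hP : ∀ N, 1 ≤ N → BDCutoff.IsBirthDeath (P N))
    (hsymm : ∀ N, 1 ≤ N → BDCutoff.IsSymmetricChain (P N))
    (hπ : ∀ N, 1 ≤ N → BDCutoff.IsStationary (P N) (π N))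
    (hlam : ∀ N, 1 ≤ N → BDCutoff.IsSpectrumEnum (P N) (lam N))
    (hX : ∀ N, 1 ≤ N → BDCutoff.IsMarkovChainFromZero (P N) (μ N) (X N))
    (hhalt : ∀ N, 1 ≤ N →
      BDCutoff.IsHaltingState (P N) (π N) (μ N) (X N) (BDCutoff.xStar N))
    -- for even `N`, the mass of the middle state `N / 2` stays away from `1`
    (hmid : ∃ δ : ℝ, 0 < δ ∧
      ∀ᶠ N in atTop, ∀ x : Fin (N + 1), 2 * (x : ℕ) = N → π N x ≤ 1 - δ)
    (hgap : Tendsto (fun N => (1 - lam N 1) * BDCutoff.invGapSum (lam N) N) atTop atTop) :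
    BDCutoff.IsCutoff (fun N => BDCutoff.tvDistAt (P N) (π N))
        (fun N => BDCutoff.meanHit (μ N) (X N) (BDCutoff.xStar N)) ∧
    Asymptotics.IsEquivalent atTop
        (fun N => BDCutoff.meanHit (μ N) (X N) (BDCutoff.xStar N))
        (fun N => (1 / 2) * BDCutoff.invGapSum (lam N) N) ∧
    (0 < liminf (fun N =>
          (((1 - lam N 1) ^ 2 * BDCutoff.varSum (lam N) N : ℝ) : EReal)) atTop →
      BDCutoff.IsCutoffWithWindow (fun N => BDCutoff.tvDistAt (P N) (π N))
          (fun N => BDCutoff.meanHit (μ N) (X N) (BDCutoff.xStar N))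
          (fun N => BDCutoff.stdHit (μ N) (X N) (BDCutoff.xStar N)) ∧
      BDCutoff.IsCutoffWithWindow (fun N => BDCutoff.tvDistAt (P N) (π N))
          (fun N => (1 / 2) * BDCutoff.invGapSum (lam N) N)
          (fun N => (1 / 2) * Real.sqrt (BDCutoff.varSum (lam N) N))) := by
  open BDCutoff in
  obtain ⟨δ, hδ, hmid⟩ := hmid
  set ε : ℝ := min δ 1 / 2 with hε_def
  have hε : 0 < ε := half_pos (lt_min hδ one_pos)
  have hmass : ∀ᶠ N in atTop, 1 ≤ N ∧ ε ≤ leftMass (π N) (xStar N) ∧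
      ε ≤ 1 - leftMass (π N) (xStar N) := by
    filter_upwards [hmid, eventually_ge_atTop 1] with N h hN
    exact ⟨hN, leftMass_xStar (hP N hN) (hsymm N hN) (hπ N hN) hN h⟩
  -- The `4` is the `2` of `leftVar_le` times the `2` of `sum_green_sq_le`; the other estimates need
  -- less.
  set C : ℝ := (1 + 1 / ε) / ε ^ 2 * 4 with hC_def
  have hC : 0 < C := by positivity
  have hC1 : (1 + 1 / ε) / ε ^ 2 ≤ C := by
    have : 0 < (1 + 1 / ε) / ε ^ 2 := by positivity
    linarith
  have hC2 : 1 / ε ^ 2 ≤ C := by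
    refine le_trans (div_le_div_of_nonneg_right ?_ (by positivity)) hC1
    have : 0 < 1 / ε := by positivity
    linarith
  have hmom := fun N (hN : 1 ≤ N) =>
    hitTimeReal_moments (hP N hN) (hπ N hN) (hX N hN) (xStar_ne_zero hN)
  have hτ : ∀ N, 1 ≤ N → 0 < 1 / (1 - lam N 1) := fun N hN =>
    one_div_pos.2 (sub_pos.2 ((hlam N hN).lt_one (hP N hN) le_rfl hN))
  have key := cutoff_of_tails (d := fun N => tvDistAt (P N) (π N))
    (t := fun N => meanHit (μ N) (X N) (xStar N))
    (v := fun N => ProbabilityTheory.variance (hitTimeReal (X N) (xStar N)) (μ N))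
    (τ := fun N => 1 / (1 - lam N 1)) (S := fun N => invGapSum (lam N) N)
    (V := fun N => varSum (lam N) N) hC ?_ ?_ ?_ ?_ ?_ ?_ ?_ ?_ ?_
  · refine ⟨key.1, key.2.1, fun h => key.2.2 ?_⟩
    -- A real number strictly between `0` and the extended liminf serves as the constant `c` in `c
    -- τ² ≤ V`.
    obtain ⟨a, ha0, ha⟩ := EReal.lt_iff_exists_real_btwn.1 h
    refine ⟨a, by exact_mod_cast ha0, ?_⟩
    filter_upwards [eventually_lt_of_lt_liminf ha, eventually_ge_atTop 1] with N h1 hN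
    have h2 : a < (1 - lam N 1) ^ 2 * varSum (lam N) N := by exact_mod_cast h1
    have h3 : 0 < 1 - lam N 1 := one_div_pos.1 (hτ N hN)
    rw [one_div, inv_pow, ← div_eq_mul_inv, div_le_iff₀ (by positivity)]
    linarith
  · filter_upwards [eventually_ge_atTop 1] with N hN n
    exact ⟨tvDist_nonneg _ _, tvDist_le_one (pow_row (hP N hN) n 0).1 (pow_row (hP N hN) n 0).2
      (hπ N hN).nonneg (hπ N hN).sum_eq_one⟩
  · filter_upwards [eventually_ge_atTop 1] with N hN n b hb hn
    rw [(hmom N hN).2.2]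
    refine (hhalt N hN n).trans ?_
    rw [measureReal_lt_hitTime (hX N hN) (xStar_ne_zero hN)]
    exact surv_le_div_sq (hP N hN) (hπ N hN) (hX N hN) (xStar_ne_zero hN) hb hn
  · filter_upwards [hmass] with N hN n k b M hb hM hn
    obtain ⟨hN, hl, hr⟩ := hN
    rw [(hmom N hN).2.2]
    have h1 := one_sub_div_sq_le_surv (hP N hN) (hπ N hN) (hX N hN) (xStar_ne_zero hN)
      (n := n + k) hb (by push_cast; exact hn)
    have h2 := surv_sub_le_tvDistAt (hP N hN) (hπ N hN) (xStar N) n k hM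
    have h3 := meanGreen_le (hP N hN) (hπ N hN) (hlam N hN) hN hε hl hr
    have h4 : meanGreen (resistance (P N) (π N)) (π N) (xStar N) / M ≤
        C * (1 / (1 - lam N 1)) / M := by
      refine div_le_div_of_nonneg_right (h3.trans ?_) hM.le
      rw [div_eq_mul_one_div, mul_comm]
      exact mul_le_mul_of_nonneg_right hC2 (hτ N hN).le
    linarith
  · filter_upwards [eventually_ge_atTop 1] with N hN using hτ N hN
  · filter_upwards [hmass] with N hN
    obtain ⟨hN, hl, hr⟩ := hN
    have h1 := abs_two_mul_leftTrace_sub_le (hP N hN) (hsymm N hN) (hπ N hN) (hlam N hN) hN hε hl hr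
      (xStar_rev_le hN)
    have h2 := mul_le_mul_of_nonneg_right hC1 (hτ N hN).le
    rw [(hmom N hN).2.1]
    rw [abs_le] at h1 ⊢
    have h3 := mul_pos hC (hτ N hN)
    constructor <;> linarith
  · filter_upwards [eventually_ge_atTop 1] with N hN
    rw [(hmom N hN).2.2]
    exact varSum_le (hP N hN) (hsymm N hN) (hπ N hN) (hlam N hN) (xStar_rev_le hN)
  · filter_upwards [hmass] with N hN
    obtain ⟨hN, hl, hr⟩ := hN
    rw [(hmom N hN).2.2]
    have h1 := leftVar_le (hP N hN) (hsymm N hN) (hπ N hN) (hlam N hN) (xStar N)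
    have h2 := sum_green_sq_le (hP N hN) (hπ N hN) (hlam N hN) hN hε hl hr
    have h3 : C * (1 / (1 - lam N 1)) ^ 2 =
        2 * (2 * (1 + 1 / ε) / ε ^ 2 * (1 / (1 - lam N 1)) ^ 2) := by
      rw [hC_def]; ring
    linarith
  · filter_upwards [eventually_ge_atTop 1] with N hN
    exact varSum_le_mul_invGapSum (hP N hN) (hlam N hN)
  · intro K
    filter_upwards [hgap.eventually_ge_atTop K, eventually_ge_atTop 1] with N h hN
    rw [mul_one_div, div_le_iff₀ (one_div_pos.1 (hτ N hN))]
    linarith
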